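/- Setting. Let $G$ be a finite simple directed graph with nonempty vertex set $V$ that is strongly connected, and let $R$ be a commutative unital ring. A cut-vertex is a vertex whose removal disconnects the underlying undirected graph; the strong blocks $G_e$ ($e\in E$) of $G$ are the maximal connected subgraphs without cut-vertices, $V_e$ is the vertex set of $G_e$ and $p_e=|V_e|$. $J$ denotes an all-ones matrix and $\operatorname{cof}(A)$ the sum of all cofactors of a square matrix $A$. A vertex $v\neq i,j$ separates $i$ from $j$ if every path from $i$ to $j$ in the underlying undirected graph passes through $v$. Given, for every $e\in E$, matrices $M_e,X_e\in R^{V_e\times V_e}$ such that $M_e$ has all diagonal entries $1$ and $X_e$ has all diagonal entries $0$, define $V\times V$ matrices $(m_{ij})$ and $(d_{ij})$ as follows: their principal submatrices on $V_e$ are $M_e$ and $X_e$ respectively, and if $i,j$ lie in no common block then $m_{ij}=m_{iv}m_{vj}$ and $d_{ij}=d_{iv}+m_{iv}d_{vj}$ for a vertex $v$ separating $i$ from $j$. (0) This is well defined: two vertices in no common block are separated by some vertex; the principal submatrices on the blocks are the prescribed ones; and the two rules hold for every vertex $v$ separating $i$ from $j$. Put $D^*_G=(m_{ij})$ for $M_e=D^*_{G_e}$.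 Given moreover $a_e\in R$ ($e\in E$), let $D_{\mathcal G_e}=a_e(D^*_{G_e}-J)$ and let $D_{\mathcal G}=(d_{ij})$ for $M_e=D^*_{G_e}$, $X_e=D_{\mathcal G_e}$. (1) For all $a_e\in R$ and all $D^*_{G_e}\in R^{V_e\times V_e}$ with unit diagonal, $$\det D_{\mathcal G}=\sum_{e}\det(D_{\mathcal G_e})\prod_{f\ne e}a_f^{p_f-1}\det(D^*_{G_f}),$$ $$\operatorname{cof} D_{\mathcal G}=\det(D^*_G)\prod_e a_e^{p_e-1}+\sum_e\bigl(\operatorname{cof}(D_{\mathcal G_e})-a_e^{p_e-1}\det(D^*_{G_e})\bigr)\prod_{f\neq e}a_f^{p_f-1}\det(D^*_{G_f}).$$ (2) For all $D^*_{G_e}$ with unit diagonal, $$\det D^*_G=\prod_e\det D^*_{G_e},\qquad \operatorname{cof}D^*_G=\prod_e\det D^*_{G_e}+\sum_e\bigl(\operatorname{cof}D^*_{G_e}-\det D^*_{G_e}\bigr)\prod_{f\ne e}\det D^*_{G_f}.$$ (3) Let $q\in R$ with $q-1$ invertible, let $A$ be an additive monoid with a distinguished element $1$ (such as $\mathbb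 N$, $\mathbb Z$, $\mathbb R$), and let $t\mapsto q^t$ be a map $A\to R$ with $q^0=1$, $q^{s+t}=q^sq^t$ and $q^1=q$. For weights $\alpha_{ij}\in A$ ($i,j\in V_e$, $e\in E$) with $\alpha_{ii}=0$, let $D_q(G)$ be the matrix $D_{\mathcal G}$ with $a_e=1/(q-1)$ and $D^*_{G_e}=(q^{\alpha_{ij}})$ for all $e$, let $D_q(G_e)=\bigl((q^{\alpha_{ij}}-1)/(q-1)\bigr)_{i,j\in V_e}$, and $d^*_e=(q-1)\det D_q(G_e)+\operatorname{cof}D_q(G_e)$. Then $$\det D_q(G)=\sum_e\det(D_q(G_e))\prod_{f\ne e}d^*_f,\qquad \operatorname{cof}D_q(G)=\prod_e d^*_e-(q-1)\sum_e\det(D_q(G_e))\prod_{f\neq e}d^*_f .$$ For $A=\mathbb N$ the same identities hold for every $q\in R$ if, with $[k]_q=1+q+\dots+q^{k-1}$, one defines $D_q(G_e)=([\alpha_{ij}]_q)$ and $D_q(G)=(d_{ij})$ for $M_e=(q^{\alpha_{ij}})$, $X_e=([\alpha_{ij}]_q)$; if $q-1$ is invertible, this is the same matrix $D_q(G)$ as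 before. (4) For weights $\alpha_{ij}\in R$ within the blocks, with $\alpha_{ii}=0$, let $D_{G_e}=(\alpha_{ij})_{i,j\in V_e}$ and let $D_G$ be the classical distance matrix, i.e. $D_G=(d_{ij})$ for $M_e=J$, $X_e=D_{G_e}$ (so $d_{ij}=d_{iv}+d_{vj}$ if $v$ separates $i$ from $j$). Then $$\det D_G=\sum_e\det(D_{G_e})\prod_{f\ne e}\operatorname{cof}(D_{G_f}),\qquad \operatorname{cof}D_G=\prod_e\operatorname{cof}(D_{G_e}).$$ Moreover $D_G=D_1(G)$: for weights in $\mathbb N$, $D_1(G)$ in the sense of the last part of (3) is $D_G$ for the images of the weights in $R$; and for real weights, $D_q(G)\to D_G$ as $q\to1$, $q\ne1$. -/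

import Mathlib

namespace GHH

section Graph

variable {V : Type*}

/-- A directed graph is simple if it has no loops (parallel edges cannot occur in a `Digraph`). -/
def IsSimple (G : Digraph V) : Prop := ∀ v, ¬ G.Adj v v

/-- Strong connectivity: there is a directed path from every vertex to every vertex. -/
def IsStronglyConnected (G : Digraph V) : Prop := ∀ u v, Relation.ReflTransGen G.Adj u v

/-- A cut-vertex of a (connected) undirected graph: its removal disconnects the graph. -/
def IsCutVertex {W : Type*} (H : SimpleGraph W) (v : W) : Prop :=
  ¬ (H.induce ({v}ᶜ : Set W)).Preconnected

/-- The underlying undirected graph of `G`, induced on `S`, is connected and has no cut-vertex. -/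
def NoCutVertex (G : Digraph V) (S : Finset V) : Prop :=
  (G.toSimpleGraphInclusive.induce (S : Set V)).Connected ∧
    ∀ v, ¬ IsCutVertex (G.toSimpleGraphInclusive.induce (S : Set V)) v

/-- (The vertex set of) a strong block of `G`: a maximal connected subgraph without cut-vertices.
Adding edges between the vertices of a subgraph never creates a cut-vertex, so maximal subgraphs
without cut-vertices are induced, and are given by their vertex sets. -/
def IsBlock (G : Digraph V) (S : Finset V) : Prop := Maximal (NoCutVertex G) S

/-- The index set `E` of the strong blocks of `G`. -/
abbrev Block (G : Digraph V) : Type _ := {S : Finset V // IsBlock G S}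

noncomputable instance [Fintype V] (G : Digraph V) : Fintype (Block G) := Fintype.ofFinite _

noncomputable instance (G : Digraph V) : DecidableEq (Block G) := Classical.decEq _

/-- The vertex `v`, different from `i` and `j`, separates `i` from `j`: these are connected
in the underlying undirected graph of `G`, but every path between them passes through `v`. -/
def Separates (G : Digraph V) (v i j : V) : Prop :=
  v ≠ i ∧ v ≠ j ∧ G.toSimpleGraphInclusive.Reachable i j ∧
    ∀ p : G.toSimpleGraphInclusive.Walk i j, v ∈ p.support

theorem Separates.dist_lt {G : Digraph V} {v i j : V} (h : Separates G v i j) :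
    G.toSimpleGraphInclusive.dist i v < G.toSimpleGraphInclusive.dist i j ∧
      G.toSimpleGraphInclusive.dist v j < G.toSimpleGraphInclusive.dist i j := by
  classical
  obtain ⟨hi, hj, hr, hw⟩ := h
  obtain ⟨p, hp⟩ := hr.exists_walk_length_eq_dist
  have hv := hw p
  have hsum : (p.takeUntil v hv).length + (p.dropUntil v hv).length = p.length := by
    rw [← SimpleGraph.Walk.length_append, SimpleGraph.Walk.take_spec]
  have h1 : (p.takeUntil v hv).length ≠ 0 := fun h0 =>
    hi (SimpleGraph.Walk.eq_of_length_eq_zero h0).symm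
  have h2 : (p.dropUntil v hv).length ≠ 0 := fun h0 =>
    hj (SimpleGraph.Walk.eq_of_length_eq_zero h0)
  have h3 := SimpleGraph.dist_le (p.takeUntil v hv)
  have h4 := SimpleGraph.dist_le (p.dropUntil v hv)
  omega

end Graph

noncomputable section

variable {V : Type*} {R : Type*} [CommRing R]

/-- A family of square matrices, one for each strong block `e`, with rows and columns indexed by
the vertices of the block. -/
abbrev BlockMatrices (G : Digraph V) (R : Type*) : Type _ :=
  ∀ e : Block G, Matrix {v // v ∈ e.1} {v // v ∈ e.1} R

open Classical in
/-- The entries `m i j` of the multiplicative distance matrix: within a block they are those of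
the given matrices `M e`, and `m i j = m i v * m v j` if `v` is a cut-vertex separating `i`
from `j`. -/
def multEntry (G : Digraph V) (M : BlockMatrices G R) (i j : V) : R :=
  if h : ∃ e : Block G, i ∈ e.1 ∧ j ∈ e.1 then
    M h.choose ⟨i, h.choose_spec.1⟩ ⟨j, h.choose_spec.2⟩
  else if h' : ∃ v, Separates G v i j then
    multEntry G M i h'.choose * multEntry G M h'.choose j
  else 0
termination_by G.toSimpleGraphInclusive.dist i j
decreasing_by
  · exact h'.choose_spec.dist_lt.1
  · exact h'.choose_spec.dist_lt.2

open Classical in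
/-- The entries `d i j` of the distance matrix with multiplicative part `M` and prescribed
principal submatrices `X e`: within a block they are those of `X e`, and
`d i j = d i v + m i v * d v j` if `v` is a cut-vertex separating `i` from `j`. -/
def addEntry (G : Digraph V) (M X : BlockMatrices G R) (i j : V) : R :=
  if h : ∃ e : Block G, i ∈ e.1 ∧ j ∈ e.1 then
    X h.choose ⟨i, h.choose_spec.1⟩ ⟨j, h.choose_spec.2⟩
  else if h' : ∃ v, Separates G v i j then
    addEntry G M X i h'.choose + multEntry G M i h'.choose * addEntry G M X h'.choose j
  else 0
termination_by G.toSimpleGraphInclusive.dist i j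
decreasing_by
  · exact h'.choose_spec.dist_lt.1
  · exact h'.choose_spec.dist_lt.2

/-- The distance matrix with multiplicative part `M` and principal submatrices `X e`. -/
def gluedDist (G : Digraph V) (M X : BlockMatrices G R) : Matrix V V R :=
  Matrix.of (addEntry G M X)

/-- The all-ones matrix `J`. -/
def J (n : Type*) (R : Type*) [CommRing R] : Matrix n n R := Matrix.of fun _ _ => 1

/-- The cofactor-sum of a square matrix. -/
def cof {n : Type*} [Fintype n] [DecidableEq n] (A : Matrix n n R) : R :=
  ∑ i, ∑ j, A.adjugate i j

/-- The multiplicative distance matrix `D*_G` with block data `M e = D*_{G_e}`. -/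
def multDist (G : Digraph V) (M : BlockMatrices G R) : Matrix V V R :=
  Matrix.of (multEntry G M)

/-- The block matrices `a e • (M e - J)` attached to the additive-multiplicative block-datum
`(a e, M e)`. -/
def amBlock (G : Digraph V) (a : Block G → R) (M : BlockMatrices G R) : BlockMatrices G R :=
  fun e => a e • (M e - J _ R)

/-- The additive-multiplicative distance matrix of `G` with block-datum `(a e, M e)`. -/
def amDist (G : Digraph V) (a : Block G → R) (M : BlockMatrices G R) : Matrix V V R :=
  gluedDist G M (amBlock G a M)

/-- The matrices `(q ^ (α i j))` of a block, where `qpow t` is `q ^ t`. -/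
def qPowBlock {A : Type*} (G : Digraph V) (qpow : A → R) (α : BlockMatrices G A) :
    BlockMatrices G R :=
  fun e => (α e).map qpow

/-- The `q`-distance matrices of the blocks, with entries `(q ^ (α i j) - 1) / (q - 1)`; here
`qpow t` is `q ^ t`, and `r` is the inverse of `q - 1`. -/
def qBlock {A : Type*} (G : Digraph V) (qpow : A → R) (r : R) (α : BlockMatrices G A) :
    BlockMatrices G R :=
  amBlock G (fun _ => r) (qPowBlock G qpow α)

/-- The `q`-distance matrix `D_q(G)`: the additive-multiplicative distance matrix with
`a e = r = 1 / (q - 1)` for all blocks `e`, and with multiplicative block data `q ^ (α i j)`. -/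
def qDist {A : Type*} (G : Digraph V) (qpow : A → R) (r : R) (α : BlockMatrices G A) :
    Matrix V V R :=
  amDist G (fun _ => r) (qPowBlock G qpow α)

/-- The `q`-integer `1 + q + ⋯ + q ^ (k - 1)`, that is `(q ^ k - 1) / (q - 1)`. -/
def qNat (q : R) (k : ℕ) : R := ∑ l ∈ Finset.range k, q ^ l

/-- The polynomial form of the `q`-distance matrices of the blocks for weights in `ℕ`, which does
not require `q - 1` to be invertible. -/
def qNatBlock (G : Digraph V) (q : R) (α : BlockMatrices G ℕ) : BlockMatrices G R :=
  fun e => (α e).map (qNat q)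

/-- The polynomial form of the `q`-distance matrix for weights in `ℕ`, which does not require
`q - 1` to be invertible. -/
def qNatDist (G : Digraph V) (q : R) (α : BlockMatrices G ℕ) : Matrix V V R :=
  gluedDist G (qPowBlock G (fun k : ℕ => q ^ k) α) (qNatBlock G q α)

/-- The quantities `d*_e = (q - 1) * det D_q(G_e) + cof D_q(G_e)`, where `B e = D_q(G_e)`. -/
def dStar {G : Digraph V} [DecidableEq V] (q : R) (B : BlockMatrices G R) (e : Block G) : R :=
  (q - 1) * (B e).det + cof (B e)

/-- The classical distance matrix `D_G` with additive weights `α i j` within the blocks: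
`d i j = d i v + d v j` if `v` is a cut-vertex separating `i` from `j`. -/
def classicalDist (G : Digraph V) (α : BlockMatrices G R) : Matrix V V R :=
  gluedDist G (fun _ => J _ R) α

end

end GHH

open GHH Finset Filter Topology

open GHH Finset Filter Topology

/-! Write D_S for the principal submatrix of D on a vertex set S. Adding w_i to every entry of row i
gives a determinant that is affine in w, namely det D_S + 1ᵀ adj(D_S) w. Its value at w = 0 is det
D_S, and its linear part at w = 1 is cof D_S. Suppose S and T meet only in v and all entries between
them are given by the rules at v. Row and column operations then leave off-diagonal blocks of rank
one, and `det_fromBlocks_vecMulVec` gives the gluing formula `shiftDet_union`. Besides the two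
affine functions it involves only the numbers 1ᵀ adj(D_S) m_{·v} and 1ᵀ adj(D_T) m_{·v}. If on each
block e this number is a constant b_e independent of v, then the same holds on unions, where it is
multiplicative; det and cof - b then obey a Leibniz rule (`det_cof_gluedDist`).

It remains to compute b_e. For X_e = a_e (M_e - J) it is a_e^(p_e - 1) det M_e. For M_e = J + c X_e
it is c det X_e + cof X_e, where c = q - 1 gives the q-distance and c = 0 the classical one. The
multiplicative case follows from a_e = 1, because then D* = D + J.

On the combinatorial side, `block_induction` assembles V from its blocks. The vertex sets that occur
are retracts of the graph (`IsRetract`), so a block of G with two vertices in such a set lies inside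
it, and separation within the set is separation in G. The entries are well defined because
separating vertices are linearly ordered (`Separates.order`). -/

namespace GHH

/-! ### Determinants with rank-one off-diagonal blocks. -/

section RankOne

open Matrix

variable {m n R : Type*} [Fintype m] [DecidableEq m] [Fintype n] [DecidableEq n] [CommRing R]

theorem adjugate_mulVec_of_isUnit {A : Matrix m m R} (hA : IsUnit A.det) (v : m → R) :
    A.adjugate *ᵥ v = A.det • (A⁻¹ *ᵥ v) := by
  rw [← smul_mulVec, Matrix.inv_def, smul_smul, Ring.mul_inverse_cancel _ hA, one_smul]

/-- The Schur complement of P is a rank-one perturbation of A, so the matrix determinant lemma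
applies. -/
theorem det_fromBlocks_vecMulVec_of_isUnit (A : Matrix m m R) (P : Matrix n n R) (u r : m → R)
    (p q : n → R) (hA : IsUnit A.det) (hP : IsUnit P.det) :
    (fromBlocks A (vecMulVec u p) (vecMulVec q r) P).det =
      A.det * P.det - (r ⬝ᵥ A.adjugate *ᵥ u) * (p ⬝ᵥ P.adjugate *ᵥ q) := by
  have := P.invertibleOfIsUnitDet hP
  have h1 : A - vecMulVec u p * ⅟P * vecMulVec q r =
      A + replicateCol Unit (-(p ⬝ᵥ P⁻¹ *ᵥ q) • u) * replicateRow Unit r := by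
    rw [sub_eq_add_neg, ← vecMulVec_eq, vecMulVec_mul, vecMulVec_mul_vecMulVec, invOf_eq_nonsing_inv,
      ← dotProduct_mulVec]
    simp [vecMulVec_smul, smul_vecMulVec]
  have h2 : (1 + replicateRow Unit r * A⁻¹ * replicateCol Unit (-(p ⬝ᵥ P⁻¹ *ᵥ q) • u)).det =
      1 - (p ⬝ᵥ P⁻¹ *ᵥ q) * (r ⬝ᵥ A⁻¹ *ᵥ u) := by
    rw [det_unique, Matrix.mul_assoc]
    simp [Matrix.mul_apply, dotProduct, mulVec, Finset.mul_sum, sub_eq_add_neg, mul_left_comm]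
  rw [det_fromBlocks₂₂, h1, det_add_replicateCol_mul_replicateRow hA,
    adjugate_mulVec_of_isUnit hA, adjugate_mulVec_of_isUnit hP, h2, dotProduct_smul,
    dotProduct_smul, smul_eq_mul, smul_eq_mul]
  ring

theorem map_dotProduct_adjugate_mulVec {S : Type*} [CommRing S] (f : R →+* S) (A : Matrix m m R)
    (r u : m → R) :
    f (r ⬝ᵥ A.adjugate *ᵥ u) = (f ∘ r) ⬝ᵥ (f.mapMatrix A).adjugate *ᵥ (f ∘ u) := by
  rw [← RingHom.map_adjugate, RingHom.map_dotProduct]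
  congr 1
  ext i
  exact RingHom.map_mulVec f _ _ i

theorem map_det_fromBlocks_vecMulVec {S : Type*} [CommRing S] (f : R →+* S) (A : Matrix m m R)
    (P : Matrix n n R) (u r : m → R) (p q : n → R) :
    f (fromBlocks A (vecMulVec u p) (vecMulVec q r) P).det =
      (fromBlocks (f.mapMatrix A) (vecMulVec (f ∘ u) (f ∘ p)) (vecMulVec (f ∘ q) (f ∘ r))
        (f.mapMatrix P)).det := by
  rw [RingHom.map_det]
  congr 1
  ext (i | i) (j | j) <;> simp [vecMulVec_apply]

/-- The determinant of a block matrix whose off-diagonal blocks have rank one. -/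
theorem det_fromBlocks_vecMulVec (A : Matrix m m R) (P : Matrix n n R) (u r : m → R)
    (p q : n → R) :
    (fromBlocks A (vecMulVec u p) (vecMulVec q r) P).det =
      A.det * P.det - (r ⬝ᵥ A.adjugate *ᵥ u) * (p ⬝ᵥ P.adjugate *ᵥ q) := by
  -- To remove invertibility, replace A and P by X + A and X + P over R[X]. Their determinants are
  -- monic, hence non-zero-divisors and units in K. The identity descends to R[X] by injectivity and
  -- is then evaluated at X = 0.
  let K := FractionRing (Polynomial R)
  let ι : Polynomial R →+* K := algebraMap _ _
  have hι : Function.Injective ι := IsFractionRing.injective (Polynomial R) K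
  let ε : Polynomial R →+* R := Polynomial.evalRingHom 0
  let A' : Matrix m m (Polynomial R) :=
    (Polynomial.X : Polynomial R) • (1 : Matrix m m (Polynomial R)) + A.map Polynomial.C
  let P' : Matrix n n (Polynomial R) :=
    (Polynomial.X : Polynomial R) • (1 : Matrix n n (Polynomial R)) + P.map Polynomial.C
  have hεA : ε.mapMatrix A' = A := by ext; simp [ε, A']
  have hεP : ε.mapMatrix P' = P := by ext; simp [ε, P']
  have hεm : ∀ v : m → R, ε ∘ (Polynomial.C ∘ v) = v := fun v => by ext; simp [ε]
  have hεn : ∀ v : n → R, ε ∘ (Polynomial.C ∘ v) = v := fun v => by ext; simp [ε]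
  have hunit : ∀ a : Polynomial R, a.Monic → IsUnit (ι a) := fun a ha =>
    IsLocalization.map_units K (⟨a, ha.mem_nonZeroDivisors⟩ : nonZeroDivisors (Polynomial R))
  have hA : IsUnit (ι.mapMatrix A').det := by
    rw [← RingHom.map_det]
    exact hunit _ (Polynomial.leadingCoeff_det_X_one_add_C A)
  have hP : IsUnit (ι.mapMatrix P').det := by
    rw [← RingHom.map_det]
    exact hunit _ (Polynomial.leadingCoeff_det_X_one_add_C P)
  have key : (fromBlocks A' (vecMulVec (Polynomial.C ∘ u) (Polynomial.C ∘ p))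
      (vecMulVec (Polynomial.C ∘ q) (Polynomial.C ∘ r)) P').det =
      A'.det * P'.det - ((Polynomial.C ∘ r) ⬝ᵥ A'.adjugate *ᵥ (Polynomial.C ∘ u)) *
        ((Polynomial.C ∘ p) ⬝ᵥ P'.adjugate *ᵥ (Polynomial.C ∘ q)) := by
    apply hι
    rw [map_det_fromBlocks_vecMulVec, det_fromBlocks_vecMulVec_of_isUnit _ _ _ _ _ _ hA hP,
      map_sub, map_mul, map_mul, map_dotProduct_adjugate_mulVec, map_dotProduct_adjugate_mulVec,
      RingHom.map_det, RingHom.map_det]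
  have := congrArg ε key
  rwa [map_det_fromBlocks_vecMulVec, map_sub, map_mul, map_mul, map_dotProduct_adjugate_mulVec,
    map_dotProduct_adjugate_mulVec, RingHom.map_det, RingHom.map_det, hεA, hεP, hεm, hεm, hεn,
    hεn] at this

/-- The matrix determinant lemma, without invertibility. -/
theorem det_add_vecMulVec (A : Matrix m m R) (u r : m → R) :
    (A + vecMulVec u r).det = A.det + r ⬝ᵥ A.adjugate *ᵥ u := by
  -- A 1 × 1 corner 1 with p = -1 and q = 1 has Schur complement A + u rᵀ.
  have h := det_fromBlocks_vecMulVec A (1 : Matrix Unit Unit R) u r (fun _ => -1) (fun _ => 1)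
  rw [det_fromBlocks_one₂₂, vecMulVec_mul_vecMulVec] at h
  have h2 : A - vecMulVec u (((fun _ : Unit => (-1 : R)) ⬝ᵥ fun _ => 1) • r) =
      A + vecMulVec u r := by
    simp [dotProduct, vecMulVec_neg]
  rw [h2] at h
  simpa [dotProduct] using h

end RankOne

/-! ### The affine dependence of the determinant on a common column shift. -/

section ColumnShift

open Matrix

variable {m R : Type*} [CommRing R]

/-- The matrix with entries `A i j + w i`. -/
def addCol (A : Matrix m m R) (w : m → R) : Matrix m m R := of fun i j => A i j + w i

theorem addCol_addCol (A : Matrix m m R) (w w' : m → R) :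
    addCol (addCol A w) w' = addCol A (w + w') := by
  ext i j
  simp [addCol, add_assoc]

theorem addCol_zero (A : Matrix m m R) : addCol A 0 = A := by
  ext i j
  simp [addCol]

variable [Fintype m] [DecidableEq m]

theorem det_addCol (A : Matrix m m R) (w : m → R) :
    (addCol A w).det = A.det + 1 ⬝ᵥ A.adjugate *ᵥ w := by
  rw [← det_add_vecMulVec]
  congr 1
  ext i j
  simp [addCol]

theorem cof_eq (A : Matrix m m R) : cof A = (addCol A 1).det - A.det := by
  rw [det_addCol]
  simp [cof, dotProduct, mulVec]

/-- The linear part of an affine function does not depend on the base point; compare the shifts by w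
and by w + u. -/
theorem one_dotProduct_adjugate_addCol (A : Matrix m m R) (w u : m → R) :
    1 ⬝ᵥ (addCol A w).adjugate *ᵥ u = 1 ⬝ᵥ A.adjugate *ᵥ u := by
  have h := det_addCol (addCol A w) u
  rw [addCol_addCol, det_addCol, det_addCol, mulVec_add, dotProduct_add] at h
  linear_combination -h

theorem one_dotProduct_adjugate_mulVec_col (A : Matrix m m R) (k : m) :
    1 ⬝ᵥ A.adjugate *ᵥ (fun i => A i k) = A.det := by
  have h : (fun i => A i k) = A *ᵥ Pi.single k 1 := by ext; simp
  rw [h, mulVec_mulVec, adjugate_mul, smul_mulVec, one_mulVec, dotProduct_smul]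
  simp

end ColumnShift

/-! ### Gluing two principal submatrices at one vertex. -/

section Gluing

open Matrix

variable {V R : Type*} [DecidableEq V] [CommRing R]

/-- The determinant of the principal submatrix on `S` of the matrix with entries `D i j + w i`. -/
noncomputable def shiftDet (D : Matrix V V R) (S : Finset V) (w : V → R) : R :=
  (addCol (D.submatrix ((↑) : {x // x ∈ S} → V) (↑)) fun i => w i).det

/-- The linear part of `shiftDet D S`. -/
noncomputable def shiftLin (D : Matrix V V R) (S : Finset V) (w : V → R) : R :=
  1 ⬝ᵥ (D.submatrix ((↑) : {x // x ∈ S} → V) (↑)).adjugate *ᵥ fun i => w i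

theorem shiftDet_zero (D : Matrix V V R) (S : Finset V) :
    shiftDet D S 0 = (D.submatrix ((↑) : {x // x ∈ S} → V) (↑)).det :=
  congrArg det (addCol_zero _)

theorem shiftDet_eq (D : Matrix V V R) (S : Finset V) (w : V → R) :
    shiftDet D S w = shiftDet D S 0 + shiftLin D S w := by
  rw [shiftDet_zero, shiftDet, det_addCol, shiftLin]

theorem shiftLin_one (D : Matrix V V R) (S : Finset V) :
    shiftLin D S 1 = cof (D.submatrix ((↑) : {x // x ∈ S} → V) (↑)) := by
  rw [cof_eq, det_addCol, add_sub_cancel_left]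
  rfl

theorem shiftLin_smul (D : Matrix V V R) (S : Finset V) (c : R) (w : V → R) :
    shiftLin D S (c • w) = c * shiftLin D S w := by
  have : (fun i : {x // x ∈ S} => (c • w) i) = c • fun i : {x // x ∈ S} => w i := rfl
  rw [shiftLin, this, mulVec_smul, dotProduct_smul, smul_eq_mul, shiftLin]

theorem shiftLin_congr {D D' : Matrix V V R} {S : Finset V} {w w' : V → R}
    (h : ∀ i ∈ S, ∀ j ∈ S, D i j = D' i j) (hw : ∀ i ∈ S, w i = w' i) :
    shiftLin D S w = shiftLin D' S w' := by
  have h1 : D.submatrix ((↑) : {x // x ∈ S} → V) ((↑) : {x // x ∈ S} → V) =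
      D'.submatrix (↑) (↑) := by
    ext i j
    exact h i i.2 j j.2
  have h2 : (fun i : {x // x ∈ S} => w i) = fun i : {x // x ∈ S} => w' i :=
    funext fun i => hw i i.2
  rw [shiftLin, h1, h2, shiftLin]

/-- A Schur-type complement of the principal submatrix of `D` on `T ∪ {v}`. -/
def schurBlock (D m : Matrix V V R) (T : Finset V) (v : V) :
    Matrix {x // x ∈ T} {x // x ∈ T} R :=
  of fun j k => D j k - D j v - m j v * D v k

/-- The correction term of `shiftDet_union_disjoint`. -/
noncomputable def shiftCorr (D m : Matrix V V R) (T : Finset V) (v : V) (w : V → R) : R :=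
  (fun k : {x // x ∈ T} => D v k) ⬝ᵥ (schurBlock D m T v).adjugate *ᵥ
    fun j : {x // x ∈ T} => D j v + w j - m j v * w v

/-- Subtract m_{jv} times row v from each row j ∈ T, and column v from each column in T. The rules
at v turn the off-diagonal blocks into m_{·v} D_{v·} and q 1ᵀ, and the corner into `schurBlock`. -/
theorem shiftDet_union_disjoint {D m : Matrix V V R} {S T : Finset V} {v : V} (hv : v ∈ S)
    (hST : Disjoint S T) (hm : m v v = 1) (h0 : D v v = 0)
    (h1 : ∀ i ∈ S, ∀ j ∈ T, D i j = D i v + m i v * D v j)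
    (h2 : ∀ i ∈ S, ∀ j ∈ T, D j i = D j v + m j v * D v i) (w : V → R) :
    shiftDet D (S ∪ T) w = shiftDet D S w * (schurBlock D m T v).det -
      shiftLin D S (fun i => m i v) * shiftCorr D m T v w := by
  set A : Matrix {x // x ∈ S} {x // x ∈ S} R :=
    addCol (D.submatrix ((↑) : {x // x ∈ S} → V) (↑)) fun i => w i with hA
  set P := schurBlock D m T v with hP
  let u : {x // x ∈ S} → R := fun i => m i v
  let p : {x // x ∈ T} → R := fun k => D v k
  let q : {x // x ∈ T} → R := fun j => D j v + w j - m j v * w v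
  let x : {x // x ∈ T} → R := fun j => m j v
  let δ : {x // x ∈ S} → R := Pi.single ⟨v, hv⟩ 1
  have key : (addCol (D.submatrix ((↑) : {x // x ∈ S ∪ T} → V) (↑)) fun i => w i).submatrix
      (Equiv.Finset.union S T hST) (Equiv.Finset.union S T hST) =
      fromBlocks 1 0 (vecMulVec x δ) 1 * fromBlocks A (vecMulVec u p) (vecMulVec q 1) P *
        fromBlocks 1 (vecMulVec δ 1) 0 1 := by
    have e1 : A *ᵥ δ = fun i : {x // x ∈ S} => D i v + w i := by
      ext i; simp [δ, hA, addCol]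
    have e2 : δ ᵥ* A = fun i : {x // x ∈ S} => D v i + w v := by
      ext i; simp [δ, hA, addCol]
    have e3 : δ ⬝ᵥ u = 1 := by simp [δ, u, hm]
    have e4 : (1 : {x // x ∈ S} → R) ⬝ᵥ δ = 1 := by simp [δ]
    simp only [fromBlocks_multiply, Matrix.one_mul, Matrix.zero_mul, Matrix.mul_one,
      Matrix.mul_zero, add_zero, mul_vecMulVec, vecMulVec_mul, add_mulVec,
      Matrix.vecMulVec_mulVec, e1, e2, e3, e4]
    ext (i | i) (j | j)
    · simp [hA, addCol]
    · simp [addCol, vecMulVec_apply, u, p, h1 i i.2 j j.2]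
      ring
    · simp [addCol, vecMulVec_apply, q, x, h2 j j.2 i i.2]
      ring
    · simp [addCol, vecMulVec_apply, q, x, p, δ, hP, schurBlock, h0]
      ring
  rw [shiftDet, ← det_submatrix_equiv_self (Equiv.Finset.union S T hST), key, det_mul, det_mul,
    det_fromBlocks_zero₁₂, det_fromBlocks_zero₂₁, det_fromBlocks_vecMulVec]
  simp only [det_one, one_mul, mul_one]
  rw [hA, one_dotProduct_adjugate_addCol]
  rfl

theorem shiftDet_singleton (D : Matrix V V R) (v : V) (w : V → R) :
    shiftDet D {v} w = D v v + w v := by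
  have : Unique {x // x ∈ ({v} : Finset V)} := ⟨⟨⟨v, Finset.mem_singleton_self v⟩⟩,
    fun a => Subtype.ext (Finset.mem_singleton.1 a.2)⟩
  rw [shiftDet, det_unique]
  have h := Finset.mem_singleton.1 (default : {x // x ∈ ({v} : Finset V)}).2
  simp [addCol, h]

theorem shiftLin_singleton (D : Matrix V V R) (v : V) (w : V → R) :
    shiftLin D {v} w = w v := by
  have h1 := shiftDet_eq D {v} w
  rw [shiftDet_singleton, shiftDet_singleton] at h1
  simpa using h1.symm

/-- The case S = {v}. It lets the Schur determinant and the correction term be rewritten through the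
submatrix on T ∪ {v} itself, which makes the final gluing formula symmetric. -/
theorem shiftDet_insert {D m : Matrix V V R} {T : Finset V} {v : V} (hT : v ∉ T)
    (hm : m v v = 1) (h0 : D v v = 0) (w : V → R) :
    shiftDet D (insert v T) w = w v * (schurBlock D m T v).det - shiftCorr D m T v w := by
  have h := shiftDet_union_disjoint (S := {v}) (T := T) (D := D) (m := m)
    (Finset.mem_singleton_self v) (by simpa using hT) hm h0
    (by intro i hi j _; rw [Finset.mem_singleton.1 hi, hm, h0]; ring)
    (by intro i hi j _; rw [Finset.mem_singleton.1 hi, h0]; ring) w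
  rwa [shiftDet_singleton, shiftLin_singleton, h0, hm, zero_add, one_mul,
    ← Finset.insert_eq] at h

/-- The shift w = m_{·v} does not change the correction term, since w_j - m_{jv} w_v = 0; only w_v =
1 times the Schur determinant remains. -/
theorem shiftLin_insert {D m : Matrix V V R} {T : Finset V} {v : V} (hT : v ∉ T)
    (hm : m v v = 1) (h0 : D v v = 0) :
    shiftLin D (insert v T) (fun i => m i v) = (schurBlock D m T v).det := by
  have h := shiftDet_eq D (insert v T) (fun i => m i v)
  rw [shiftDet_insert hT hm h0, shiftDet_insert hT hm h0] at h
  have hc : shiftCorr D m T v (fun i => m i v) = shiftCorr D m T v 0 := by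
    simp [shiftCorr, hm]
  rw [hc, hm] at h
  simp only [Pi.zero_apply] at h
  linear_combination -h

/-- The gluing formula for two principal submatrices that share one row and column. -/
theorem shiftDet_union {D m : Matrix V V R} {S T : Finset V} {v : V} (hST : S ∩ T = {v})
    (hm : m v v = 1) (h0 : D v v = 0)
    (h1 : ∀ i ∈ S, ∀ j ∈ T, D i j = D i v + m i v * D v j)
    (h2 : ∀ i ∈ S, ∀ j ∈ T, D j i = D j v + m j v * D v i) (w : V → R) :
    shiftDet D (S ∪ T) w =
      shiftDet D S w * shiftLin D T (fun i => m i v) +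
        shiftLin D S (fun i => m i v) * shiftDet D T w -
        w v * (shiftLin D S (fun i => m i v) * shiftLin D T (fun i => m i v)) := by
  have hv : v ∈ S ∩ T := hST ▸ Finset.mem_singleton_self v
  obtain ⟨hvS, hvT⟩ := Finset.mem_inter.1 hv
  have hU : S ∪ T = S ∪ T.erase v := by
    ext x
    by_cases hx : x = v <;> simp [hx, hvS]
  have hd : Disjoint S (T.erase v) := by
    rw [Finset.disjoint_left]
    intro x hx hx'
    have : x ∈ S ∩ T := Finset.mem_inter.2 ⟨hx, Finset.mem_of_mem_erase hx'⟩
    rw [hST, Finset.mem_singleton] at this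
    exact Finset.ne_of_mem_erase hx' this
  have hT := Finset.insert_erase hvT
  have e1 := shiftDet_insert (D := D) (Finset.notMem_erase v T) hm h0 w
  have e2 := shiftLin_insert (D := D) (Finset.notMem_erase v T) hm h0
  rw [hT] at e1 e2
  rw [hU, shiftDet_union_disjoint hvS hd hm h0 (fun i hi j hj => h1 i hi j (Finset.mem_of_mem_erase hj))
    (fun i hi j hj => h2 i hi j (Finset.mem_of_mem_erase hj)), e1, e2]
  ring

end Gluing

/-! ### Connectivity by closed subsets, and maximality of blocks. -/

section Connectivity

variable {V : Type*}

/-- `T` has no proper nonempty subset that is closed under adjacency within `T`. -/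
def SetConn (H : SimpleGraph V) (T : Set V) : Prop :=
  ∀ A ⊆ T, A.Nonempty → (∀ x ∈ A, ∀ y ∈ T, H.Adj x y → y ∈ A) → T ⊆ A

theorem preconnected_induce_iff {H : SimpleGraph V} {T : Set V} :
    (H.induce T).Preconnected ↔ SetConn H T := by
  constructor
  · rintro h A hAT ⟨x, hx⟩ hA y hy
    obtain ⟨p⟩ := h ⟨x, hAT hx⟩ ⟨y, hy⟩
    have : ∀ {a b : T}, (H.induce T).Walk a b → (a : V) ∈ A → (b : V) ∈ A := by
      intro a b p
      induction p with
      | nil => exact id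
      | cons h _ ih => exact fun ha => ih (hA _ ha _ (Subtype.property _) h)
    exact this p hx
  · intro h x y
    have := h (Subtype.val '' {z : T | (H.induce T).Reachable x z})
      (by rintro _ ⟨z, -, rfl⟩; exact z.2) ⟨x, x, SimpleGraph.Reachable.refl _, rfl⟩
      (by
        rintro _ ⟨z, hz, rfl⟩ y hy hzy
        exact ⟨⟨y, hy⟩, hz.trans (SimpleGraph.Adj.reachable (by simpa using hzy)), rfl⟩) y.2
    obtain ⟨z, hz, hzy⟩ := this
    rwa [← Subtype.ext hzy]

theorem setConn_induce_iff {H : SimpleGraph V} {S : Set V} {T : Set S} :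
    SetConn (H.induce S) T ↔ SetConn H (Subtype.val '' T) := by
  constructor
  · rintro h A hAT ⟨x, hx⟩ hA _ ⟨y, hy, rfl⟩
    obtain ⟨x, -, rfl⟩ := hAT hx
    refine h (Subtype.val ⁻¹' A) ?_ ⟨x, hx⟩ ?_ hy
    · intro z hz
      obtain ⟨z', hz', e⟩ := hAT hz
      rwa [← Subtype.ext e]
    · intro a ha b hb hab
      exact hA _ ha _ ⟨b, hb, rfl⟩ hab
  · rintro h A hAT ⟨x, hx⟩ hA y hy
    have := h (Subtype.val '' A) (Set.image_mono hAT) ⟨x, x, hx, rfl⟩ (by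
      rintro _ ⟨a, ha, rfl⟩ _ ⟨b, hb, rfl⟩ hab
      exact ⟨b, hA a ha b hb hab, rfl⟩) ⟨y, hy, rfl⟩
    obtain ⟨z, hz, e⟩ := this
    rwa [← Subtype.ext e]

theorem SetConn.of_subsingleton {H : SimpleGraph V} {T : Set V} (hT : T.Subsingleton) :
    SetConn H T := by
  rintro A hAT ⟨x, hx⟩ - y hy
  rwa [hT hy (hAT hx)]

theorem SetConn.union {H : SimpleGraph V} {S T : Set V} (hS : SetConn H S) (hT : SetConn H T)
    (hST : (S ∩ T).Nonempty) : SetConn H (S ∪ T) := by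
  obtain ⟨z, hzS, hzT⟩ := hST
  rintro A hA ⟨x, hx⟩ hcl
  have aux : ∀ U : Set V, U ⊆ S ∪ T → SetConn H U → (A ∩ U).Nonempty → U ⊆ A := by
    intro U hU hc hne
    refine (hc (A ∩ U) Set.inter_subset_right hne ?_).trans Set.inter_subset_left
    exact fun a ha b hb hab => ⟨hcl a ha.1 b (hU hb) hab, hb⟩
  have auxS := aux S Set.subset_union_left hS
  have auxT := aux T Set.subset_union_right hT
  rcases hA hx with h | h
  · have hSA := auxS ⟨x, hx, h⟩
    exact Set.union_subset hSA (auxT ⟨z, hSA hzS, hzT⟩)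
  · have hTA := auxT ⟨x, hx, h⟩
    exact Set.union_subset (auxS ⟨z, hTA hzT, hzS⟩) hTA

/-- Moves the definition from nested induced subgraphs to subsets of V. Letting v range over all of
V is harmless: for v ∉ S the condition is connectivity of S. -/
theorem noCutVertex_iff {G : Digraph V} {S : Finset V} :
    NoCutVertex G S ↔ S.Nonempty ∧ SetConn G.toSimpleGraphInclusive (S : Set V) ∧
      ∀ v, SetConn G.toSimpleGraphInclusive ((S : Set V) \ {v}) := by
  have h1 : ∀ v : (S : Set V), IsCutVertex (G.toSimpleGraphInclusive.induce (S : Set V)) v ↔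
      ¬ SetConn G.toSimpleGraphInclusive ((S : Set V) \ {(v : V)}) := by
    intro v
    have : (Subtype.val '' ({v}ᶜ : Set (S : Set V)) : Set V) = (S : Set V) \ {(v : V)} := by
      ext x
      constructor
      · rintro ⟨y, hy, rfl⟩
        exact ⟨y.2, fun h => hy (Subtype.ext h)⟩
      · rintro ⟨hx, hxv⟩
        exact ⟨⟨x, hx⟩, fun h => hxv (congrArg Subtype.val h), rfl⟩
    rw [IsCutVertex, preconnected_induce_iff, setConn_induce_iff, this]
  rw [NoCutVertex, SimpleGraph.connected_iff, preconnected_induce_iff]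
  simp only [h1, not_not]
  constructor
  · rintro ⟨⟨hc, hn⟩, hv⟩
    refine ⟨hn.elim fun x => ⟨x, x.2⟩, hc, fun v => ?_⟩
    by_cases hvS : v ∈ S
    · exact hv ⟨v, hvS⟩
    · rwa [Set.sdiff_singleton_eq_self (by simpa using hvS)]
  · rintro ⟨hn, hc, hv⟩
    exact ⟨⟨hc, hn.elim fun x hx => ⟨⟨x, hx⟩⟩⟩, fun v => hv v⟩

/-- After deletion of any v, one of the two common vertices survives and joins the two connected
pieces. -/
theorem NoCutVertex.union [DecidableEq V] {G : Digraph V} {S T : Finset V} (hS : NoCutVertex G S)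
    (hT : NoCutVertex G T) {x y : V} (hxy : x ≠ y) (hxS : x ∈ S) (hxT : x ∈ T) (hyS : y ∈ S)
    (hyT : y ∈ T) : NoCutVertex G (S ∪ T) := by
  rw [noCutVertex_iff] at *
  refine ⟨⟨x, Finset.mem_union_left _ hxS⟩, ?_, fun v => ?_⟩
  · rw [Finset.coe_union]
    exact hS.2.1.union hT.2.1 ⟨x, hxS, hxT⟩
  · rw [Finset.coe_union, Set.union_sdiff_distrib]
    refine (hS.2.2 v).union (hT.2.2 v) ?_
    by_cases hxv : x = v
    · exact ⟨y, ⟨hyS, fun h => hxy (hxv.trans h.symm)⟩, hyT, fun h => hxy (hxv.trans h.symm)⟩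
    · exact ⟨x, ⟨hxS, hxv⟩, hxT, hxv⟩

theorem noCutVertex_pair [DecidableEq V] {G : Digraph V} {x y : V}
    (h : G.toSimpleGraphInclusive.Adj x y) : NoCutVertex G {x, y} := by
  rw [noCutVertex_iff]
  have hc : SetConn G.toSimpleGraphInclusive (({x, y} : Finset V) : Set V) := by
    rintro A hA ⟨z, hz⟩ hcl w hw
    have hzm := hA hz
    simp only [coe_insert, coe_singleton, Set.mem_insert_iff, Set.mem_singleton_iff] at hzm hw hcl
    have := hcl z hz w hw
    rcases hzm with rfl | rfl <;> rcases hw with rfl | rfl <;> first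
      | exact hz
      | exact this h
      | exact this h.symm
  refine ⟨⟨x, by simp⟩, hc, fun v => ?_⟩
  by_cases hv : v ∈ ({x, y} : Finset V)
  · apply SetConn.of_subsingleton
    rintro a ⟨ha, hav⟩ b ⟨hb, hbv⟩
    simp only [coe_insert, coe_singleton, Set.mem_insert_iff, Set.mem_singleton_iff,
      Finset.mem_insert, Finset.mem_singleton] at ha hb hav hbv hv
    grind
  · rwa [Set.sdiff_singleton_eq_self (by simpa using hv)]

theorem noCutVertex_singleton {G : Digraph V} (x : V) : NoCutVertex G {x} := by
  rw [noCutVertex_iff]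
  refine ⟨⟨x, by simp⟩, .of_subsingleton (by simp), fun v => .of_subsingleton ?_⟩
  exact Set.Subsingleton.anti (by simp) Set.sdiff_subset

theorem NoCutVertex.exists_block [Fintype V] {G : Digraph V} {S : Finset V}
    (hS : NoCutVertex G S) : ∃ e : Block G, S ⊆ e.1 := by
  obtain ⟨T, hST, hT⟩ := (Set.toFinite {S : Finset V | NoCutVertex G S}).exists_le_maximal hS
  exact ⟨⟨T, hT⟩, hST⟩

theorem Block.noCutVertex {G : Digraph V} (e : Block G) : NoCutVertex G e.1 := e.2.prop

/-- By maximality both blocks equal their union. Hence distinct blocks share at most one vertex. -/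
theorem Block.ext_of_mem [DecidableEq V] {G : Digraph V} {e f : Block G} {x y : V} (hxy : x ≠ y)
    (hxe : x ∈ e.1) (hye : y ∈ e.1) (hxf : x ∈ f.1) (hyf : y ∈ f.1) : e = f := by
  have h := e.noCutVertex.union f.noCutVertex hxy hxe hxf hye hyf
  apply Subtype.ext
  exact (e.2.eq_of_le h Finset.subset_union_left).trans
    (f.2.eq_of_le h Finset.subset_union_right).symm

theorem IsStronglyConnected.preconnected {G : Digraph V} (hG : IsStronglyConnected G) :
    G.toSimpleGraphInclusive.Preconnected := by
  intro u v
  induction hG u v with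
  | refl => exact SimpleGraph.Reachable.refl _
  | @tail b c _ hbc ih =>
    by_cases h : b = c
    · exact h ▸ ih
    · exact ih.trans (SimpleGraph.Adj.reachable (by
        simp [Digraph.toSimpleGraphInclusive, SimpleGraph.fromRel_adj, h, hbc]))

theorem SetConn.univ_of_preconnected {H : SimpleGraph V} (h : H.Preconnected) :
    SetConn H Set.univ := by
  rw [← preconnected_induce_iff]
  exact (SimpleGraph.induceUnivIso H).preconnected_iff.2 h

end Connectivity

/-! ### Separating vertices and their order. -/

section Separation

variable {V : Type*} {G : Digraph V}

theorem Separates.symm {v i j : V} (h : Separates G v i j) : Separates G v j i :=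
  ⟨h.2.1, h.1, h.2.2.1.symm, fun p => by simpa using h.2.2.2 p.reverse⟩

theorem separates_of_closed (hG : G.toSimpleGraphInclusive.Preconnected) {A : Set V} {v i j : V}
    (hv : v ∉ A) (hi : i ∈ A) (hj : j ∉ A) (hvj : v ≠ j)
    (hA : ∀ x ∈ A, ∀ y, y ≠ v → G.toSimpleGraphInclusive.Adj x y → y ∈ A) :
    Separates G v i j := by
  refine ⟨fun h => hv (h ▸ hi), hvj, hG i j, fun p => ?_⟩
  by_contra hp
  have : ∀ {a b : V} (p : G.toSimpleGraphInclusive.Walk a b), v ∉ p.support → a ∈ A → b ∈ A := by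
    intro a b p
    induction p with
    | nil => exact fun _ => id
    | @cons a c b h p ih =>
      intro hp ha
      rw [SimpleGraph.Walk.support_cons, List.mem_cons, not_or] at hp
      exact ih hp.2 (hA a ha c (fun h => hp.2 (h ▸ p.start_mem_support)) h)
  exact hj (this p hp hi)

/-- The vertices of S reachable from i by walks avoiding v form a closed subset of the connected set
S \ {v}, hence all of it. -/
theorem NoCutVertex.not_separates {S : Finset V} (hS : NoCutVertex G S) {v i j : V} (hi : i ∈ S)
    (hj : j ∈ S) : ¬ Separates G v i j := by
  rintro ⟨hvi, hvj, -, hw⟩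
  have h := (noCutVertex_iff.1 hS).2.2 v
    {x | x ∈ (S : Set V) \ {v} ∧ ∃ p : G.toSimpleGraphInclusive.Walk i x, v ∉ p.support}
    (fun x hx => hx.1) ⟨i, ⟨hi, hvi.symm⟩, .nil, by simpa using hvi⟩ (by
      rintro x ⟨-, p, hp⟩ y hy hxy
      refine ⟨hy, p.concat hxy, ?_⟩
      rw [SimpleGraph.Walk.support_concat, List.mem_append, List.mem_singleton, not_or]
      exact ⟨hp, fun h => hy.2 h.symm⟩)
  obtain ⟨-, p, hp⟩ := h (show j ∈ (S : Set V) \ {v} from ⟨hj, hvj.symm⟩)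
  exact hp (hw p)

/-- Any walk from i to c followed by q must meet v, but q avoids v. The initial segment of the path
p up to v avoids c, so every continuation from v to j must meet c. -/
theorem Separates.separates_of_walk {v c i j : V} (hv : Separates G v i j) (hc : Separates G c i j)
    (hvc : v ≠ c) (p : G.toSimpleGraphInclusive.Walk i c) (q : G.toSimpleGraphInclusive.Walk c j)
    (hp : p.IsPath) (hq : v ∉ q.support) : Separates G v i c ∧ Separates G c v j := by
  classical
  have hvp : v ∈ p.support := by
    have := hv.2.2.2 (p.append q)
    rw [SimpleGraph.Walk.mem_support_append_iff] at this
    exact this.resolve_right hq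
  refine ⟨⟨hv.1, hvc, p.reachable, fun r => ?_⟩, ⟨hvc.symm, hc.2.1, ?_, fun r => ?_⟩⟩
  · have := hv.2.2.2 (r.append q)
    rw [SimpleGraph.Walk.mem_support_append_iff] at this
    exact this.resolve_right hq
  · exact (p.takeUntil v hvp).reachable.symm.trans hv.2.2.1
  · have := hc.2.2.2 ((p.takeUntil v hvp).append r)
    rw [SimpleGraph.Walk.mem_support_append_iff] at this
    exact this.resolve_left (SimpleGraph.Walk.endpoint_notMem_support_takeUntil hp hvp hvc.symm)

/-- Two vertices that separate `i` from `j` are linearly ordered between `i` and `j`. -/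
theorem Separates.order {v c i j : V} (hv : Separates G v i j) (hc : Separates G c i j)
    (hvc : v ≠ c) : (Separates G v i c ∧ Separates G c v j) ∨
      (Separates G c i v ∧ Separates G v c j) := by
  classical
  obtain ⟨p, hp⟩ := hv.2.2.1.exists_isPath
  have hcp := hc.2.2.2 p
  by_cases h : v ∈ (p.dropUntil c hcp).support
  · right
    have h' : v ∉ (p.takeUntil c hcp).support := by
      intro h'
      rw [← p.take_spec hcp] at hp
      exact hp.ne_of_mem_support_of_append hvc h' h rfl
    have := hv.symm.separates_of_walk hc.symm hvc (p.dropUntil c hcp).reverse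
      (p.takeUntil c hcp).reverse (hp.dropUntil hcp).reverse (by simpa using h')
    exact ⟨this.2.symm, this.1.symm⟩
  · exact Or.inl (hv.separates_of_walk hc hvc _ _ (hp.takeUntil hcp) h)

end Separation

/-! ### Retracts and induction over the block decomposition. -/

section Decomposition

variable {V : Type*} {G : Digraph V}

/-- `V` retracts onto `S` so that every edge outside `S` is collapsed. -/
def IsRetract (H : SimpleGraph V) (S : Finset V) : Prop :=
  ∃ ρ : V → V, (∀ x, ρ x ∈ S) ∧ (∀ x ∈ S, ρ x = x) ∧
    ∀ x y, H.Adj x y → ρ x = ρ y ∨ (x ∈ S ∧ y ∈ S)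

theorem IsRetract.setConn {H : SimpleGraph V} {S : Finset V} (hS : IsRetract H S)
    (hH : SetConn H Set.univ) : SetConn H (S : Set V) := by
  obtain ⟨ρ, h1, h2, h3⟩ := hS
  rintro A hA ⟨x, hx⟩ hcl y hy
  have h := hH (ρ ⁻¹' A) (Set.subset_univ _) ⟨x, by rwa [Set.mem_preimage, h2 x (hA hx)]⟩ (by
    intro a ha b _ hab
    rcases h3 a b hab with h | ⟨haS, hbS⟩
    · rwa [Set.mem_preimage, ← h]
    · rw [Set.mem_preimage, h2 _ haS] at ha
      rw [Set.mem_preimage, h2 _ hbS]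
      exact hcl a ha b hbS hab) (Set.mem_univ y)
  rwa [Set.mem_preimage, h2 y hy] at h

/-- If f ∈ F lies outside S, the vertices of F outside S with the same image as f are closed in F \
{ρ f} and so exhaust it. But s or t differs from ρ f and lies in S. -/
theorem IsRetract.subset {S F : Finset V} (hS : IsRetract G.toSimpleGraphInclusive S)
    (hF : NoCutVertex G F) {s t : V} (hst : s ≠ t) (hs : s ∈ S) (ht : t ∈ S) (hsF : s ∈ F)
    (htF : t ∈ F) : F ⊆ S := by
  obtain ⟨ρ, h1, h2, h3⟩ := hS
  intro f hf
  by_contra hfS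
  have hcon : ∀ u ∈ S, u ∈ F → u ≠ ρ f → False := by
    intro u hu huF hne
    have h := (noCutVertex_iff.1 hF).2.2 (ρ f)
      {x | (x ∈ F ∧ x ≠ ρ f) ∧ x ∉ S ∧ ρ x = ρ f} (fun x hx => hx.1)
      ⟨f, ⟨hf, fun h => hfS (h ▸ h1 f)⟩, hfS, rfl⟩ (by
        rintro x ⟨-, hxS, hx⟩ y hy hxy
        have hρ : ρ y = ρ f := by
          rcases h3 x y hxy with h | h
          · rw [← h, hx]
          · exact absurd h.1 hxS
        exact ⟨hy, fun hyS => hy.2 ((h2 y hyS).symm.trans hρ), hρ⟩)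
    exact (h (show u ∈ (F : Set V) \ {ρ f} from ⟨huF, hne⟩)).2.1 hu
  by_cases h : s = ρ f
  · exact hcon t ht htF (fun h' => hst (h.trans h'.symm))
  · exact hcon s hs hsF h

/-- The preimage of A under the retraction is closed away from v, so walks in the whole graph cannot
leave it without v. If v ∉ S, then A would be closed in the connected set S, contradicting j. -/
theorem IsRetract.separates {S : Finset V} (hS : IsRetract G.toSimpleGraphInclusive S)
    (hG : G.toSimpleGraphInclusive.Preconnected) {A : Finset V} {v i j : V} (hA : A ⊆ S)
    (hv : v ∉ A) (hi : i ∈ A) (hj : j ∈ S) (hjA : j ∉ A) (hvj : v ≠ j)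
    (hcl : ∀ x ∈ A, ∀ y ∈ S, y ≠ v → G.toSimpleGraphInclusive.Adj x y → y ∈ A) :
    Separates G v i j := by
  obtain ⟨ρ, h1, h2, h3⟩ := hS
  by_cases hvS : v ∈ S
  · refine separates_of_closed hG (A := {x | ρ x ∈ A}) ?_ ?_ ?_ hvj ?_
    · simpa [h2 v hvS] using hv
    · simpa [h2 i (hA hi)] using hi
    · simpa [h2 j hj] using hjA
    · intro x hx y hyv hxy
      rcases h3 x y hxy with h | ⟨hxS, hyS⟩
      · rwa [Set.mem_ofPred_eq, ← h]
      · rw [Set.mem_ofPred_eq, h2 x hxS] at hx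
        rw [Set.mem_ofPred_eq, h2 y hyS]
        exact hcl x hx y hyS hyv hxy
  · have hconn := IsRetract.setConn ⟨ρ, h1, h2, h3⟩ (SetConn.univ_of_preconnected hG)
    exact absurd (hconn A hA ⟨i, hi⟩
      (fun x hx y hy hxy => hcl x hx y hy (fun h => hvS (h ▸ hy)) hxy) hj) hjA

/-- Collapse B to v: with no edges between A and B, every edge of S with an end in B joins B to B or
to v. -/
theorem IsRetract.of_insert [DecidableEq V] {H : SimpleGraph V} {A B : Finset V} {v : V}
    (hS : IsRetract H (insert v (A ∪ B))) (hvB : v ∉ B) (hAB : Disjoint A B)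
    (hadj : ∀ a ∈ A, ∀ b ∈ B, ¬ H.Adj a b) : IsRetract H (insert v A) := by
  obtain ⟨ρ, h1, h2, h3⟩ := hS
  have hmem : ∀ x, x ∈ insert v (A ∪ B) → x ∉ B → x ∈ insert v A := by
    intro x hx hxB
    simp only [Finset.mem_insert, Finset.mem_union] at hx ⊢
    tauto
  have hsub : ∀ x, x ∈ insert v A → x ∈ insert v (A ∪ B) ∧ x ∉ B := by
    intro x hx
    simp only [Finset.mem_insert, Finset.mem_union] at hx ⊢
    rcases hx with rfl | hx
    · exact ⟨Or.inl rfl, hvB⟩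
    · exact ⟨Or.inr (Or.inl hx), Finset.disjoint_left.1 hAB hx⟩
  refine ⟨fun x => if ρ x ∈ B then v else ρ x, fun x => ?_, fun x hx => ?_, fun x y hxy => ?_⟩
  · dsimp only
    split_ifs with h
    · exact Finset.mem_insert_self _ _
    · exact hmem _ (h1 x) h
  · dsimp only
    rw [h2 x (hsub x hx).1, if_neg (hsub x hx).2]
  · rcases h3 x y hxy with h | ⟨hx, hy⟩
    · exact Or.inl (by simp only [h])
    · dsimp only
      rw [h2 x hx, h2 y hy]
      by_cases hxB : x ∈ B <;> by_cases hyB : y ∈ B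
      · exact Or.inl (by rw [if_pos hxB, if_pos hyB])
      · rcases Finset.mem_insert.1 (hmem y hy hyB) with rfl | hyA
        · exact Or.inl (by rw [if_pos hxB, if_neg hyB])
        · exact absurd hxy.symm (hadj y hyA x hxB)
      · rcases Finset.mem_insert.1 (hmem x hx hxB) with rfl | hxA
        · exact Or.inl (by rw [if_neg hxB, if_pos hyB])
        · exact absurd hxy (hadj x hxA y hyB)
      · exact Or.inr ⟨hmem x hx hxB, hmem y hy hyB⟩

/-- F \ {v} is connected, and no edge crosses from A to B. -/
theorem NoCutVertex.subset_or_subset [DecidableEq V] {A B F : Finset V} {v : V}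
    (hF : NoCutVertex G F) (hFS : F ⊆ insert v (A ∪ B))
    (hvA : v ∉ A)
    (hadj : ∀ a ∈ A, ∀ b ∈ B, ¬ G.toSimpleGraphInclusive.Adj a b) :
    F ⊆ insert v A ∨ F ⊆ insert v B := by
  by_cases hne : ∃ x ∈ F, x ∈ A
  · left
    obtain ⟨x, hxF, hxA⟩ := hne
    have h := (noCutVertex_iff.1 hF).2.2 v {x | x ∈ F ∧ x ∈ A}
      (fun x hx => ⟨hx.1, fun h => hvA (h ▸ hx.2)⟩) ⟨x, hxF, hxA⟩ (by
        rintro a ⟨-, ha⟩ b ⟨hbF, hbv⟩ hab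
        have hb := hFS hbF
        simp only [Finset.mem_insert, Finset.mem_union] at hb
        refine ⟨hbF, ?_⟩
        rcases hb with hb | hb | hb
        · exact absurd hb hbv
        · exact hb
        · exact absurd hab (hadj a ha b hb))
    intro y hy
    by_cases hyv : y = v
    · exact hyv ▸ Finset.mem_insert_self _ _
    · exact Finset.mem_insert_of_mem (h (show y ∈ (F : Set V) \ {v} from ⟨hy, hyv⟩)).2
  · right
    intro y hy
    have := hFS hy
    simp only [Finset.mem_insert, Finset.mem_union] at this ⊢
    have : y ∉ A := fun h => hne ⟨y, hy, h⟩
    tauto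

/-- A vertex of a connected graph with at least two vertices has a neighbour, and the edge has no
cut-vertex, so a singleton is not maximal. -/
theorem Block.two_le_card [Fintype V] [DecidableEq V] (hG : G.toSimpleGraphInclusive.Preconnected)
    (hV : 2 ≤ Fintype.card V) (e : Block G) : 2 ≤ #e.1 := by
  by_contra hcard
  obtain ⟨v, hv⟩ := (noCutVertex_iff.1 e.noCutVertex).1
  have he : e.1 = {v} := by
    rw [Finset.eq_singleton_iff_unique_mem]
    refine ⟨hv, fun x hx => ?_⟩
    exact Finset.card_le_one.1 (by omega) x hx v hv
  have : Nontrivial V := Fintype.one_lt_card_iff_nontrivial.1 hV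
  obtain ⟨w, hw⟩ := exists_ne v
  obtain ⟨u, hu⟩ : ∃ u, G.toSimpleGraphInclusive.Adj v u := by
    by_contra! hno
    have := SetConn.univ_of_preconnected hG {v} (Set.subset_univ _) ⟨v, rfl⟩
      (fun x hx y _ hxy => absurd (Set.mem_singleton_iff.1 hx ▸ hxy) (hno y)) (Set.mem_univ w)
    exact hw this
  have h := e.2.le_of_ge (noCutVertex_pair hu) (by
    rw [he]
    intro x hx
    rw [Finset.mem_singleton.1 hx]
    exact Finset.mem_insert_self _ _)
  have : u ∈ e.1 := h (by simp)
  rw [he, Finset.mem_singleton] at this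
  exact hu.ne this.symm

theorem exists_split [DecidableEq V] {H : SimpleGraph V} {S : Finset V} {v : V}
    (hv : v ∈ S) (h : ¬ SetConn H ((S : Set V) \ {v})) :
    ∃ A B : Finset V, A.Nonempty ∧ B.Nonempty ∧ Disjoint A B ∧ v ∉ A ∧ v ∉ B ∧
      S = insert v (A ∪ B) ∧ ∀ a ∈ A, ∀ b ∈ B, ¬ H.Adj a b := by
  classical
  simp only [SetConn] at h
  push Not at h
  obtain ⟨A, hAS, ⟨x, hx⟩, hcl, hne⟩ := h
  obtain ⟨y, hy, hyA⟩ := Set.not_subset.1 hne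
  refine ⟨S.filter (· ∈ A), (S.erase v).filter (· ∉ A), ⟨x, ?_⟩, ⟨y, ?_⟩, ?_, ?_, ?_, ?_, ?_⟩
  · exact Finset.mem_filter.2 ⟨(hAS hx).1, hx⟩
  · exact Finset.mem_filter.2 ⟨Finset.mem_erase.2 ⟨hy.2, hy.1⟩, hyA⟩
  · rw [Finset.disjoint_left]
    intro a ha hb
    exact (Finset.mem_filter.1 hb).2 (Finset.mem_filter.1 ha).2
  · exact fun h => (hAS (Finset.mem_filter.1 h).2).2 rfl
  · simp
  · ext z
    simp only [Finset.mem_insert, Finset.mem_union, Finset.mem_filter, Finset.mem_erase]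
    grind
  · intro a ha b hb hab
    rw [Finset.mem_filter, Finset.mem_erase] at hb
    exact hb.2 (hcl a (Finset.mem_filter.1 ha).2 b ⟨hb.1.2, hb.1.1⟩ hab)

/-- Induction over the block decomposition: a property of vertex sets that holds for the blocks and
is inherited by unions of two sets glued at a separating vertex holds for the whole graph. -/
theorem block_induction [Fintype V] [DecidableEq V] [Nonempty V]
    (hG : G.toSimpleGraphInclusive.Preconnected) {P : Finset V → Prop}
    (block : ∀ e : Block G, P e.1)
    (glue : ∀ (S T : Finset V) (v : V), S ∩ T = {v} →
      (∀ i ∈ S, ∀ j ∈ T, i ≠ v → j ≠ v → Separates G v i j) →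
      (∀ e : Block G, e.1 ⊆ S ∪ T → e.1 ⊆ S ∨ e.1 ⊆ T) →
      (∀ e : Block G, e.1 ⊆ S → ¬ e.1 ⊆ T) → P S → P T → P (S ∪ T)) :
    P univ := by
  -- Two vertices of S are needed to pull the block containing S back into S; the one-vertex graph
  -- is the only exception.
  have hbase : ∀ S : Finset V, IsRetract G.toSimpleGraphInclusive S → NoCutVertex G S →
      (2 ≤ #S ∨ S = univ) → P S := by
    intro S hS hcut hcard
    obtain ⟨e, he⟩ := hcut.exists_block
    have : e.1 = S := by
      refine Finset.Subset.antisymm ?_ he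
      rcases hcard with hcard | rfl
      · obtain ⟨s, hs, t, ht, hst⟩ := Finset.one_lt_card.1 hcard
        exact hS.subset e.noCutVertex hst hs ht (he hs) (he ht)
      · exact Finset.subset_univ _
    exact this ▸ block e
  by_cases hV : 2 ≤ Fintype.card V
  · have hmain : ∀ (n : ℕ) (S : Finset V), #S ≤ n → IsRetract G.toSimpleGraphInclusive S →
        2 ≤ #S → P S := by
      intro n
      induction n with
      | zero => intro S h1 _ h2; omega
      | succ n ih =>
        intro S hn hS hcard
        by_cases hcut : NoCutVertex G S
        · exact hbase S hS hcut (Or.inl hcard)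
        have hconn := hS.setConn (SetConn.univ_of_preconnected hG)
        obtain ⟨v, hv⟩ : ∃ v, ¬ SetConn G.toSimpleGraphInclusive ((S : Set V) \ {v}) := by
          by_contra! h
          exact hcut (noCutVertex_iff.2 ⟨Finset.card_pos.1 (by omega), hconn, h⟩)
        have hvS : v ∈ S := by
          by_contra hvS
          rw [Set.sdiff_singleton_eq_self (by simpa using hvS)] at hv
          exact hv hconn
        obtain ⟨A, B, hA, hB, hAB, hvA, hvB, rfl, hadj⟩ := exists_split hvS hv
        have hadj' : ∀ b ∈ B, ∀ a ∈ A, ¬ G.toSimpleGraphInclusive.Adj b a :=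
          fun b hb a ha h => hadj a ha b hb h.symm
        have hA' := hA.card_pos
        have hB' := hB.card_pos
        rw [Finset.card_insert_of_notMem (by simp [hvA, hvB]), Finset.card_union_of_disjoint hAB]
          at hn
        have hU : insert v (A ∪ B) = insert v A ∪ insert v B := by
          ext x; simp only [Finset.mem_insert, Finset.mem_union]; tauto
        have hI : insert v A ∩ insert v B = {v} := by
          rw [← Finset.insert_inter_distrib, Finset.disjoint_iff_inter_eq_empty.1 hAB]
          rfl
        have hcA := Finset.card_insert_of_notMem hvA
        have hcB := Finset.card_insert_of_notMem hvB
        have hRA := hS.of_insert hvB hAB hadj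
        have hRB := (Finset.union_comm A B ▸ hS).of_insert hvA hAB.symm hadj'
        have hsplit : ∀ e : Block G, e.1 ⊆ insert v A ∪ insert v B →
            e.1 ⊆ insert v A ∨ e.1 ⊆ insert v B := fun e he =>
          e.noCutVertex.subset_or_subset (hU ▸ he) hvA hadj
        rw [hU]
        refine glue _ _ v hI ?_ hsplit ?_ (ih _ (by omega) hRA (by omega))
          (ih _ (by omega) hRB (by omega))
        · intro i hi j hj hiv hjv
          have hiA := (Finset.mem_insert.1 hi).resolve_left hiv
          have hjB := (Finset.mem_insert.1 hj).resolve_left hjv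
          refine hS.separates hG (A := A) ?_ hvA hiA ?_ (Finset.disjoint_right.1 hAB hjB)
            hjv.symm ?_
          · exact Finset.subset_union_left.trans (Finset.subset_insert _ _)
          · simp [hjB]
          · intro x hx y hy hyv hxy
            simp only [Finset.mem_insert, Finset.mem_union] at hy
            rcases hy with hy | hy | hy
            · exact absurd hy hyv
            · exact hy
            · exact absurd hxy (hadj x hx y hy)
        -- A block inside both sides would lie in {v}, but it has at least two vertices.
        · intro e h1 h2
          have := Finset.card_le_card (Finset.subset_inter h1 h2)
          rw [hI, Finset.card_singleton] at this
          have := e.two_le_card hG hV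
          omega
    exact hmain _ univ le_rfl ⟨id, by simp, by simp, by simp⟩ hV
  · have hsub : Subsingleton V := Fintype.card_le_one_iff_subsingleton.1 (by omega)
    refine hbase univ ⟨id, by simp, by simp, by simp⟩ ?_ (Or.inr rfl)
    rw [noCutVertex_iff]
    exact ⟨univ_nonempty, .of_subsingleton (Set.subsingleton_of_subsingleton),
      fun v => .of_subsingleton (Set.subsingleton_of_subsingleton)⟩

theorem mem_common_block_or_separates [Fintype V] [DecidableEq V] [Nonempty V]
    (hG : G.toSimpleGraphInclusive.Preconnected) (i j : V) :
    (∃ e : Block G, i ∈ e.1 ∧ j ∈ e.1) ∨ ∃ v, Separates G v i j := by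
  have h := block_induction hG
    (P := fun S => ∀ i ∈ S, ∀ j ∈ S, (∃ e : Block G, i ∈ e.1 ∧ j ∈ e.1) ∨ ∃ v, Separates G v i j)
    (fun e i hi j hj => Or.inl ⟨e, hi, hj⟩) (by
      intro S T v hI hsep _ _ hS hT i hi j hj
      have hv : v ∈ S ∩ T := hI ▸ Finset.mem_singleton_self v
      obtain ⟨hvS, hvT⟩ := Finset.mem_inter.1 hv
      have cross : ∀ i ∈ S, ∀ j ∈ T,
          (∃ e : Block G, i ∈ e.1 ∧ j ∈ e.1) ∨ ∃ v, Separates G v i j := by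
        intro i hi j hj
        by_cases hiv : i = v
        · exact hT i (hiv ▸ hvT) j hj
        by_cases hjv : j = v
        · exact hS i hi j (hjv ▸ hvS)
        exact Or.inr ⟨v, hsep i hi j hj hiv hjv⟩
      rcases Finset.mem_union.1 hi with hi | hi <;> rcases Finset.mem_union.1 hj with hj | hj
      · exact hS i hi j hj
      · exact cross i hi j hj
      · rcases cross j hj i hi with ⟨e, h1, h2⟩ | ⟨v, h⟩
        · exact Or.inl ⟨e, h2, h1⟩
        · exact Or.inr ⟨v, h.symm⟩
      · exact hT i hi j hj)
  exact h i (Finset.mem_univ i) j (Finset.mem_univ j)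

end Decomposition

/-! ### Well-definedness of the entries and their limits. -/

section Entries

variable {V R : Type*} {G : Digraph V}

theorem Separates.not_mem_common_block {v i j : V} (h : Separates G v i j) :
    ¬ ∃ e : Block G, i ∈ e.1 ∧ j ∈ e.1 := fun ⟨e, hi, hj⟩ =>
  e.noCutVertex.not_separates hi hj h

/-- The chosen block matters only for i = j, where all blocks carry the same constant. -/
theorem BlockMatrices.apply_eq [DecidableEq V] {M : BlockMatrices G R} {c : R} (hM : ∀ e i, M e i i = c)
    {e f : Block G} {i j : V} (hie : i ∈ e.1) (hje : j ∈ e.1) (hif : i ∈ f.1) (hjf : j ∈ f.1) :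
    M e ⟨i, hie⟩ ⟨j, hje⟩ = M f ⟨i, hif⟩ ⟨j, hjf⟩ := by
  by_cases hij : i = j
  · subst hij
    rw [hM, hM]
  · obtain rfl := Block.ext_of_mem hij hie hje hif hjf
    rfl

variable [DecidableEq V] [CommRing R]

theorem multEntry_block {M : BlockMatrices G R} (hM : ∀ e i, M e i i = 1) (e : Block G)
    (i j : {v // v ∈ e.1}) : multEntry G M i j = M e i j := by
  have h : ∃ e : Block G, i.1 ∈ e.1 ∧ j.1 ∈ e.1 := ⟨e, i.2, j.2⟩
  rw [multEntry, dif_pos h]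
  exact BlockMatrices.apply_eq hM _ _ _ _

theorem addEntry_block {M X : BlockMatrices G R} (hX : ∀ e i, X e i i = 0) (e : Block G)
    (i j : {v // v ∈ e.1}) : addEntry G M X i j = X e i j := by
  have h : ∃ e : Block G, i.1 ∈ e.1 ∧ j.1 ∈ e.1 := ⟨e, i.2, j.2⟩
  rw [addEntry, dif_pos h]
  exact BlockMatrices.apply_eq hX _ _ _ _

/-- The definition uses some separating vertex c. As v and c are ordered between i and j, expanding
at both gives the same threefold product in either order; induction is on the distance. -/
theorem multEntry_of_separates (M : BlockMatrices G R) {v i j : V} (h : Separates G v i j) :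
    multEntry G M i j = multEntry G M i v * multEntry G M v j := by
  obtain ⟨c, hc, hval⟩ : ∃ c, Separates G c i j ∧
      multEntry G M i j = multEntry G M i c * multEntry G M c j := by
    have h' : ∃ v, Separates G v i j := ⟨v, h⟩
    refine ⟨h'.choose, h'.choose_spec, ?_⟩
    rw [multEntry, dif_neg h.not_mem_common_block, dif_pos h']
  by_cases hvc : v = c
  · rw [hvc, hval]
  rcases h.order hc hvc with ⟨h1, h2⟩ | ⟨h1, h2⟩
  · rw [hval, multEntry_of_separates M h1, multEntry_of_separates M h2, mul_assoc]
  · rw [hval, multEntry_of_separates M h1, multEntry_of_separates M h2, mul_assoc]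
termination_by G.toSimpleGraphInclusive.dist i j
decreasing_by
  · exact hc.dist_lt.1
  · exact h.dist_lt.2
  · exact h.dist_lt.1
  · exact hc.dist_lt.2

theorem addEntry_of_separates (M X : BlockMatrices G R) {v i j : V} (h : Separates G v i j) :
    addEntry G M X i j = addEntry G M X i v + multEntry G M i v * addEntry G M X v j := by
  obtain ⟨c, hc, hval⟩ : ∃ c, Separates G c i j ∧
      addEntry G M X i j = addEntry G M X i c + multEntry G M i c * addEntry G M X c j := by
    have h' : ∃ v, Separates G v i j := ⟨v, h⟩
    refine ⟨h'.choose, h'.choose_spec, ?_⟩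
    rw [addEntry, dif_neg h.not_mem_common_block, dif_pos h']
  by_cases hvc : v = c
  · rw [hvc, hval]
  rcases h.order hc hvc with ⟨h1, h2⟩ | ⟨h1, h2⟩
  · rw [hval, multEntry_of_separates M h1, addEntry_of_separates M X h1,
      addEntry_of_separates M X h2]
    ring
  · rw [hval, multEntry_of_separates M h1, addEntry_of_separates M X h1,
      addEntry_of_separates M X h2]
    ring
termination_by G.toSimpleGraphInclusive.dist i j
decreasing_by
  · exact hc.dist_lt.1
  · exact h.dist_lt.2
  · exact h.dist_lt.1
  · exact hc.dist_lt.2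

variable [Fintype V] [Nonempty V]

/-- The two rules agree under m = 1 + c d, since (1 + c x)(1 + c y) = 1 + c (x + (1 + c x) y). -/
theorem multEntry_eq_one_add (hG : G.toSimpleGraphInclusive.Preconnected)
    {M X : BlockMatrices G R} (hM : ∀ e i, M e i i = 1) (hX : ∀ e i, X e i i = 0) {c : R}
    (hMX : ∀ e i j, M e i j = 1 + c * X e i j) (i j : V) :
    multEntry G M i j = 1 + c * addEntry G M X i j := by
  rcases mem_common_block_or_separates hG i j with ⟨e, hi, hj⟩ | ⟨v, h⟩
  · rw [multEntry_block hM e ⟨i, hi⟩ ⟨j, hj⟩, addEntry_block hX e ⟨i, hi⟩ ⟨j, hj⟩, hMX]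
  · have h1 := multEntry_eq_one_add hG hM hX hMX i v
    have h2 := multEntry_eq_one_add hG hM hX hMX v j
    rw [multEntry_of_separates M h, addEntry_of_separates M X h, h1, h2]
    ring
termination_by G.toSimpleGraphInclusive.dist i j
decreasing_by
  · exact h.dist_lt.1
  · exact h.dist_lt.2

theorem tendsto_multEntry [TopologicalSpace R] [IsTopologicalRing R] {ι : Type*} {l : Filter ι}
    (hG : G.toSimpleGraphInclusive.Preconnected) {M : ι → BlockMatrices G R}
    {M₀ : BlockMatrices G R} (hM : ∀ t e i, M t e i i = 1) (hM₀ : ∀ e i, M₀ e i i = 1)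
    (hlim : ∀ e i j, Tendsto (fun t => M t e i j) l (𝓝 (M₀ e i j))) (i j : V) :
    Tendsto (fun t => multEntry G (M t) i j) l (𝓝 (multEntry G M₀ i j)) := by
  rcases mem_common_block_or_separates hG i j with ⟨e, hi, hj⟩ | ⟨v, h⟩
  · have h1 := fun t => multEntry_block (hM t) e ⟨i, hi⟩ ⟨j, hj⟩
    have h2 := multEntry_block hM₀ e ⟨i, hi⟩ ⟨j, hj⟩
    simp only at h1 h2
    simp only [h1, h2]
    exact hlim _ _ _
  · have h1 := tendsto_multEntry hG hM hM₀ hlim i v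
    have h2 := tendsto_multEntry hG hM hM₀ hlim v j
    simp only [multEntry_of_separates _ h]
    exact h1.mul h2
termination_by G.toSimpleGraphInclusive.dist i j
decreasing_by
  · exact h.dist_lt.1
  · exact h.dist_lt.2

theorem tendsto_addEntry [TopologicalSpace R] [IsTopologicalRing R] {ι : Type*} {l : Filter ι}
    (hG : G.toSimpleGraphInclusive.Preconnected) {M X : ι → BlockMatrices G R}
    {M₀ X₀ : BlockMatrices G R} (hM : ∀ t e i, M t e i i = 1) (hM₀ : ∀ e i, M₀ e i i = 1)
    (hX : ∀ t e i, X t e i i = 0) (hX₀ : ∀ e i, X₀ e i i = 0)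
    (hMlim : ∀ e i j, Tendsto (fun t => M t e i j) l (𝓝 (M₀ e i j)))
    (hXlim : ∀ e i j, Tendsto (fun t => X t e i j) l (𝓝 (X₀ e i j))) (i j : V) :
    Tendsto (fun t => addEntry G (M t) (X t) i j) l (𝓝 (addEntry G M₀ X₀ i j)) := by
  rcases mem_common_block_or_separates hG i j with ⟨e, hi, hj⟩ | ⟨v, h⟩
  · have h1 := fun t => addEntry_block (M := M t) (hX t) e ⟨i, hi⟩ ⟨j, hj⟩
    have h2 := addEntry_block (M := M₀) hX₀ e ⟨i, hi⟩ ⟨j, hj⟩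
    simp only at h1 h2
    simp only [h1, h2]
    exact hXlim _ _ _
  · have h1 := tendsto_addEntry hG hM hM₀ hX hX₀ hMlim hXlim i v
    have h2 := tendsto_addEntry hG hM hM₀ hX hX₀ hMlim hXlim v j
    simp only [addEntry_of_separates _ _ h]
    exact h1.add ((tendsto_multEntry hG hM hM₀ hMlim i v).mul h2)
termination_by G.toSimpleGraphInclusive.dist i j
decreasing_by
  · exact h.dist_lt.1
  · exact h.dist_lt.2

end Entries

/-! ### The Leibniz rule over disjoint sets of blocks. -/

section LeibnizSum

variable {ι R : Type*} [DecidableEq ι] [CommRing R]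

/-- The sum that arises by applying the Leibniz rule to `∏ e ∈ s, b e`. -/
def leibnizSum (s : Finset ι) (x b : ι → R) : R := ∑ e ∈ s, x e * ∏ f ∈ s.erase e, b f

theorem leibnizSum_union {s t : Finset ι} (hst : Disjoint s t) (x b : ι → R) :
    leibnizSum (s ∪ t) x b =
      leibnizSum s x b * ∏ f ∈ t, b f + (∏ f ∈ s, b f) * leibnizSum t x b := by
  rw [leibnizSum, Finset.sum_union hst, leibnizSum, leibnizSum, Finset.sum_mul, Finset.mul_sum]
  congr 1
  · refine Finset.sum_congr rfl fun e he => ?_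
    rw [Finset.erase_union_distrib, Finset.erase_eq_of_notMem (Finset.disjoint_left.1 hst he),
      Finset.prod_union (hst.mono_left (Finset.erase_subset _ _)), mul_assoc]
  · refine Finset.sum_congr rfl fun e he => ?_
    rw [Finset.erase_union_distrib, Finset.erase_eq_of_notMem (Finset.disjoint_right.1 hst he),
      Finset.prod_union (hst.mono_right (Finset.erase_subset _ _))]
    ring

end LeibnizSum

/-! ### The constants b_e of single blocks. -/

section Matrices

open Matrix

variable {m n R : Type*} [Fintype m] [DecidableEq m] [Fintype n] [DecidableEq n] [CommRing R]

theorem cof_submatrix_equiv (e : n ≃ m) (A : Matrix m m R) : cof (A.submatrix e e) = cof A := by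
  have h : addCol (A.submatrix e e) 1 = (addCol A 1).submatrix e e := rfl
  rw [cof_eq, cof_eq, h, det_submatrix_equiv_self, det_submatrix_equiv_self]

theorem cof_addCol_one (A : Matrix m m R) : cof (addCol A 1) = cof A := by
  rw [cof_eq, det_addCol (addCol A 1), one_dotProduct_adjugate_addCol, add_sub_cancel_left,
    cof_eq, det_addCol, add_sub_cancel_left]

theorem one_dotProduct_adjugate_one (A : Matrix m m R) : 1 ⬝ᵥ A.adjugate *ᵥ 1 = cof A := by
  rw [cof_eq, det_addCol, add_sub_cancel_left]

theorem one_dotProduct_adjugate_of_eq_one_add {A M : Matrix m m R} {c : R}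
    (h : ∀ i j, M i j = 1 + c * A i j) (v : m) :
    1 ⬝ᵥ A.adjugate *ᵥ (fun i => M i v) = c * A.det + cof A := by
  have : (fun i => M i v) = c • (fun i => A i v) + 1 := by
    ext i
    simp [h, add_comm]
  rw [this, mulVec_add, mulVec_smul, dotProduct_add, dotProduct_smul,
    one_dotProduct_adjugate_mulVec_col, one_dotProduct_adjugate_one, smul_eq_mul]

/-- a times column v of M is column v of a(M - J) plus the constant a. The first contributes det(a(M
- J)), and the second completes it to det(aM). -/
theorem mul_one_dotProduct_adjugate (a : R) (M : Matrix m m R) (v : m) :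
    a * (1 ⬝ᵥ (a • (M - J m R)).adjugate *ᵥ fun i => M i v) = a ^ Fintype.card m * M.det := by
  rw [← smul_eq_mul, ← dotProduct_smul, ← mulVec_smul]
  have h1 : a • (fun i => M i v) = (fun i => (a • (M - J m R)) i v) + a • 1 := by
    ext i
    simp [J]
    ring
  have h2 : addCol (a • (M - J m R)) (a • 1) = a • M := by
    ext i j
    simp [J, addCol]
    ring
  rw [h1, mulVec_add, dotProduct_add, one_dotProduct_adjugate_mulVec_col, ← det_addCol, h2,
    det_smul]

/-- A factor a must be cancelled from the previous identity although a may be a zero divisor: cancel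
the regular element X in R[X], then evaluate at a. -/
theorem one_dotProduct_adjugate_smul_sub (a : R) (M : Matrix m m R) (v : m) :
    1 ⬝ᵥ (a • (M - J m R)).adjugate *ᵥ (fun i => M i v) = a ^ (Fintype.card m - 1) * M.det := by
  have hm : Fintype.card m - 1 + 1 = Fintype.card m :=
    Nat.sub_add_cancel (Fintype.card_pos_iff.2 ⟨v⟩)
  let M' : Matrix m m (Polynomial R) := Polynomial.C.mapMatrix M
  have key : 1 ⬝ᵥ ((Polynomial.X : Polynomial R) • (M' - J m _)).adjugate *ᵥ (fun i => M' i v) =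
      Polynomial.X ^ (Fintype.card m - 1) * M'.det := by
    apply Polynomial.isRegular_X.left
    show Polynomial.X * _ = Polynomial.X * _
    rw [mul_one_dotProduct_adjugate, ← mul_assoc, ← pow_succ', hm]
  have h := congrArg (Polynomial.evalRingHom a) key
  have e1 : (Polynomial.evalRingHom a).mapMatrix M' = M := by
    ext i j
    simp [M']
  have e2 : (Polynomial.evalRingHom a).mapMatrix ((Polynomial.X : Polynomial R) • (M' - J m _)) =
      a • (M - J m R) := by
    ext i j
    simp [M', J]
  have e3 : (Polynomial.evalRingHom a) ∘ (1 : m → Polynomial R) = 1 := by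
    ext i
    simp
  have e4 : (Polynomial.evalRingHom a) ∘ (fun i => M' i v) = fun i => M i v := by
    ext i
    simp [M']
  rw [map_dotProduct_adjugate_mulVec, e2, e3, e4, map_mul, RingHom.map_det, e1] at h
  simpa using h

end Matrices

/-! ### Assembling the blocks. -/

section Main

open Matrix

variable {V R : Type*} [CommRing R] {G : Digraph V}

theorem amBlock_diag {a : Block G → R} {M : BlockMatrices G R} (hM : ∀ e i, M e i i = 1)
    (e : Block G) (i : {v // v ∈ e.1}) : amBlock G a M e i i = 0 := by
  simp [amBlock, J, hM]

variable [DecidableEq V]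

theorem gluedDist_submatrix {M X : BlockMatrices G R} (hX : ∀ e i, X e i i = 0) (e : Block G) :
    (gluedDist G M X).submatrix ((↑) : {v // v ∈ e.1} → V) (↑) = X e := by
  ext i j
  exact addEntry_block hX e i j

variable [Fintype V] [Nonempty V]

/-- The determinant and the cofactor sum of a glued matrix, in terms of those of the blocks and of
the quantities `b e = 1ᵀ adj(X e) (M e) δ_v`, provided that these do not depend on `v`. -/
theorem det_cof_gluedDist (hG : G.toSimpleGraphInclusive.Preconnected) {M X : BlockMatrices G R}
    (hM : ∀ e i, M e i i = 1) (hX : ∀ e i, X e i i = 0) {b : Block G → R}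
    (hb : ∀ e v, 1 ⬝ᵥ (X e).adjugate *ᵥ (fun i => M e i v) = b e) :
    (gluedDist G M X).det = ∑ e, (X e).det * ∏ f ∈ univ.erase e, b f ∧
    cof (gluedDist G M X) =
      (∏ e, b e) + ∑ e, (cof (X e) - b e) * ∏ f ∈ univ.erase e, b f := by
  set D := gluedDist G M X with hD
  set m := multDist G M with hm
  have hmm : ∀ v, m v v = 1 := by
    intro v
    obtain ⟨e, he⟩ := (noCutVertex_singleton (G := G) v).exists_block
    have hv := he (Finset.mem_singleton_self v)
    exact (multEntry_block hM e ⟨v, hv⟩ ⟨v, hv⟩).trans (hM _ _)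
  have hDD : ∀ v, D v v = 0 := by
    intro v
    obtain ⟨e, he⟩ := (noCutVertex_singleton (G := G) v).exists_block
    have hv := he (Finset.mem_singleton_self v)
    exact (addEntry_block hX e ⟨v, hv⟩ ⟨v, hv⟩).trans (hX _ _)
  let B : Finset V → Finset (Block G) := fun S => univ.filter fun e => e.1 ⊆ S
  have hBe : ∀ e : Block G, B e.1 = {e} := by
    intro e
    ext f
    simp only [B, Finset.mem_filter, Finset.mem_univ, true_and, Finset.mem_singleton]
    exact ⟨fun h => Subtype.ext (f.2.eq_of_le e.noCutVertex h), fun h => h ▸ Finset.Subset.rfl⟩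
  -- The first clause needs every v ∈ S, because a later gluing may take place at any vertex of S.
  have hmain := block_induction hG (P := fun S =>
    (∀ v ∈ S, shiftLin D S (fun i => m i v) = ∏ e ∈ B S, b e) ∧
    shiftDet D S 0 = leibnizSum (B S) (fun e => (X e).det) b ∧
    shiftLin D S 1 = ∏ e ∈ B S, b e + leibnizSum (B S) (fun e => cof (X e) - b e) b) ?_ ?_
  · obtain ⟨-, h1, h2⟩ := hmain
    have hBu : B univ = univ := by simp [B]
    rw [shiftDet_zero, hBu] at h1
    rw [shiftLin_one, hBu] at h2
    let φ : {x // x ∈ (univ : Finset V)} ≃ V := Equiv.subtypeUnivEquiv Finset.mem_univ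
    exact ⟨(det_submatrix_equiv_self φ D).symm.trans h1, (cof_submatrix_equiv φ D).symm.trans h2⟩
  · intro e
    have hs := gluedDist_submatrix (M := M) hX e
    simp only [hBe, Finset.prod_singleton, leibnizSum, Finset.sum_singleton, Finset.erase_singleton,
      Finset.prod_empty, mul_one]
    rw [shiftDet_zero, shiftLin_one, hD, hs]
    refine ⟨fun v hv => ?_, rfl, by ring⟩
    rw [shiftLin, hs, ← hb e ⟨v, hv⟩]
    congr 2
    ext i
    exact multEntry_block hM e i ⟨v, hv⟩
  · rintro S T v hI hsep hcov hdis ⟨hS1, hS2, hS3⟩ ⟨hT1, hT2, hT3⟩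
    have hv : v ∈ S ∩ T := hI ▸ Finset.mem_singleton_self v
    obtain ⟨hvS, hvT⟩ := Finset.mem_inter.1 hv
    have hBU : B (S ∪ T) = B S ∪ B T := by
      ext e
      simp only [B, Finset.mem_filter, Finset.mem_univ, true_and, Finset.mem_union]
      exact ⟨hcov e, fun h => h.elim (fun h => h.trans Finset.subset_union_left)
        fun h => h.trans Finset.subset_union_right⟩
    have hBd : Disjoint (B S) (B T) := by
      rw [Finset.disjoint_left]
      simp only [B, Finset.mem_filter, Finset.mem_univ, true_and]
      exact hdis
    have hd : ∀ i j, (i = v ∨ j = v ∨ Separates G v i j) →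
        D i j = D i v + m i v * D v j ∧ m i j = m i v * m v j := by
      rintro i j (rfl | rfl | h)
      · simp [hmm, hDD]
      · simp [hmm, hDD]
      · exact ⟨addEntry_of_separates M X h, multEntry_of_separates M h⟩
    have hST : ∀ i ∈ S, ∀ j ∈ T, i = v ∨ j = v ∨ Separates G v i j := by
      intro i hi j hj
      by_cases h1 : i = v
      · exact Or.inl h1
      by_cases h2 : j = v
      · exact Or.inr (Or.inl h2)
      exact Or.inr (Or.inr (hsep i hi j hj h1 h2))
    have hTS : ∀ i ∈ S, ∀ j ∈ T, j = v ∨ i = v ∨ Separates G v j i := by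
      intro i hi j hj
      rcases hST i hi j hj with h | h | h
      · exact Or.inr (Or.inl h)
      · exact Or.inl h
      · exact Or.inr (Or.inr h.symm)
    have hglue := shiftDet_union hI (hmm v) (hDD v) (fun i hi j hj => (hd i j (hST i hi j hj)).1)
      (fun i hi j hj => (hd j i (hTS i hi j hj)).1)
    -- The linear part of the gluing formula is its value at w minus its value at 0.
    have hlin : ∀ w, shiftLin D (S ∪ T) w =
        shiftLin D S w * shiftLin D T (fun i => m i v) +
          shiftLin D S (fun i => m i v) * shiftLin D T w -
          w v * (shiftLin D S (fun i => m i v) * shiftLin D T (fun i => m i v)) := by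
      intro w
      have h1 := hglue w
      have h0 := hglue 0
      rw [shiftDet_eq D _ w, shiftDet_eq D S w, shiftDet_eq D T w] at h1
      rw [Pi.zero_apply] at h0
      linear_combination h1 - h0
    have hSv := hS1 v hvS
    have hTv := hT1 v hvT
    rw [hBU, Finset.prod_union hBd, leibnizSum_union hBd, leibnizSum_union hBd]
    refine ⟨fun w hw => ?_, ?_, ?_⟩
    · rcases Finset.mem_union.1 hw with hw | hw
      -- Seen from T, the vertex w lies behind v, so m_{·w} is proportional to m_{·v} on T and the
      -- last two terms of `hlin` cancel.
      · have : shiftLin D T (fun i => m i w) = m v w * shiftLin D T (fun i => m i v) := by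
          rw [← shiftLin_smul]
          refine shiftLin_congr (fun _ _ _ _ => rfl) fun i hi => ?_
          rw [(hd i w (hTS w hw i hi)).2, Pi.smul_apply, smul_eq_mul, mul_comm]
        rw [hlin, this, hSv, hTv, hS1 w hw]
        ring
      · have : shiftLin D S (fun i => m i w) = m v w * shiftLin D S (fun i => m i v) := by
          rw [← shiftLin_smul]
          refine shiftLin_congr (fun _ _ _ _ => rfl) fun i hi => ?_
          rw [(hd i w (hST i hi w hw)).2, Pi.smul_apply, smul_eq_mul, mul_comm]
        rw [hlin, this, hSv, hTv, hT1 w hw]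
        ring
    · rw [hglue, hSv, hTv, hS2, hT2, Pi.zero_apply]
      ring
    · rw [hlin, hSv, hTv, hS3, hT3, Pi.one_apply]
      ring

/-- Here b_e = c det X_e + cof X_e, so the Leibniz terms cof X_e - b_e become -c det X_e. -/
theorem det_cof_gluedDist_of_eq_one_add (hG : G.toSimpleGraphInclusive.Preconnected)
    {M X : BlockMatrices G R} (hX : ∀ e i, X e i i = 0) {c : R}
    (hMX : ∀ e i j, M e i j = 1 + c * X e i j) :
    (gluedDist G M X).det =
      ∑ e, (X e).det * ∏ f ∈ univ.erase e, (c * (X f).det + cof (X f)) ∧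
    cof (gluedDist G M X) = (∏ e, (c * (X e).det + cof (X e))) -
      c * ∑ e, (X e).det * ∏ f ∈ univ.erase e, (c * (X f).det + cof (X f)) := by
  have h := det_cof_gluedDist hG (fun e i => by rw [hMX, hX, mul_zero, add_zero]) hX
    (fun e v => one_dotProduct_adjugate_of_eq_one_add (hMX e) v)
  refine ⟨h.1, h.2.trans ?_⟩
  rw [Finset.mul_sum, sub_eq_add_neg, ← Finset.sum_neg_distrib]
  congr 1
  exact Finset.sum_congr rfl fun e _ => by ring

theorem det_cof_amDist (hG : G.toSimpleGraphInclusive.Preconnected) (a : Block G → R)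
    {M : BlockMatrices G R} (hM : ∀ e i, M e i i = 1) :
    (amDist G a M).det =
      ∑ e, (amBlock G a M e).det * ∏ f ∈ univ.erase e, a f ^ (#f.1 - 1) * (M f).det ∧
    cof (amDist G a M) =
      (∏ e : Block G, a e ^ (#e.1 - 1) * (M e).det) +
        ∑ e, (cof (amBlock G a M e) - a e ^ (#e.1 - 1) * (M e).det) *
          ∏ f ∈ univ.erase e, a f ^ (#f.1 - 1) * (M f).det :=
  det_cof_gluedDist hG hM (amBlock_diag hM) fun e v => by
    rw [← Fintype.card_coe e.1]
    exact one_dotProduct_adjugate_smul_sub (a e) (M e) v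

/-- For a_e = 1 one has D* = D + J, on the blocks and globally. Adding J fixes cof and adds cof to
det. -/
theorem det_cof_multDist (hG : G.toSimpleGraphInclusive.Preconnected) {M : BlockMatrices G R}
    (hM : ∀ e i, M e i i = 1) :
    (multDist G M).det = ∏ e, (M e).det ∧
    cof (multDist G M) =
      (∏ e, (M e).det) + ∑ e, (cof (M e) - (M e).det) * ∏ f ∈ univ.erase e, (M f).det := by
  have h := det_cof_amDist hG (fun _ => 1) hM
  simp only [one_pow, one_mul] at h
  have hX : ∀ e : Block G, addCol (amBlock G (fun _ => 1) M e) 1 = M e := by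
    intro e
    ext i j
    simp [addCol, amBlock, J]
  have hD : addCol (amDist G (fun _ => 1) M) 1 = multDist G M := by
    ext i j
    have := multEntry_eq_one_add hG hM (amBlock_diag (a := fun _ => 1) hM) (c := 1)
      (fun e i j => by simp [amBlock, J]) i j
    rw [one_mul] at this
    exact (add_comm _ _).trans this.symm
  have hc : ∀ e : Block G, cof (amBlock G (fun _ => 1) M e) = cof (M e) := fun e => by
    rw [← cof_addCol_one, hX]
  have hdet : ∀ e : Block G, (amBlock G (fun _ => 1) M e).det = (M e).det - cof (M e) := fun e => by
    have := cof_eq (amBlock G (fun _ => 1) M e)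
    rw [hX, hc] at this
    rw [this, sub_sub_cancel]
  have hcof := cof_eq (amDist G (fun _ => 1) M)
  rw [hD] at hcof
  simp only [hc, hdet] at h
  refine ⟨?_, by rw [← hD, cof_addCol_one, h.2]⟩
  have hs : ∑ e : Block G, (cof (M e) - (M e).det) * ∏ f ∈ univ.erase e, (M f).det =
      -∑ e : Block G, ((M e).det - cof (M e)) * ∏ f ∈ univ.erase e, (M f).det := by
    rw [← Finset.sum_neg_distrib]
    exact Finset.sum_congr rfl fun e _ => by ring
  rw [h.1, h.2, hs] at hcof
  linear_combination -hcof

theorem pow_eq_one_add_mul_qNat (q : R) (k : ℕ) : q ^ k = 1 + (q - 1) * qNat q k := by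
  rw [qNat, mul_geom_sum, add_sub_cancel]

end Main

end GHH

theorem mainTheorem8 {V : Type*} [Fintype V] [DecidableEq V] [Nonempty V]
    (G : Digraph V) (hsimple : IsSimple G) (hG : IsStronglyConnected G)
    {R : Type*} [CommRing R] :
    -- the inductive definition of the distance matrices makes sense: the rules for the entries
    -- determine the matrices, and they hold for every choice of the separating cut-vertex
    ((∀ i j, (∃ e : Block G, i ∈ e.1 ∧ j ∈ e.1) ∨ ∃ v, Separates G v i j) ∧
      ∀ M X : BlockMatrices G R, (∀ e i, M e i i = 1) → (∀ e i, X e i i = 0) →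
        (∀ e i j, multDist G M i.1 j.1 = M e i j) ∧
        (∀ v i j, Separates G v i j →
          multDist G M i j = multDist G M i v * multDist G M v j) ∧
        (∀ e i j, gluedDist G M X i.1 j.1 = X e i j) ∧
        (∀ v i j, Separates G v i j →
          gluedDist G M X i j = gluedDist G M X i v + multDist G M i v * gluedDist G M X v j)) ∧
    -- additive-multiplicative distance matrices
    (∀ (a : Block G → R) (M : BlockMatrices G R), (∀ e i, M e i i = 1) →
      (amDist G a M).det =
        ∑ e, (amBlock G a M e).det * ∏ f ∈ univ.erase e, a f ^ (#f.1 - 1) * (M f).det ∧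
      cof (amDist G a M) =
        (multDist G M).det * (∏ e : Block G, a e ^ (#e.1 - 1)) +
          ∑ e, (cof (amBlock G a M e) - a e ^ (#e.1 - 1) * (M e).det) *
            ∏ f ∈ univ.erase e, a f ^ (#f.1 - 1) * (M f).det) ∧
    -- multiplicative distance matrices
    (∀ M : BlockMatrices G R, (∀ e i, M e i i = 1) →
      (multDist G M).det = ∏ e, (M e).det ∧
      cof (multDist G M) =
        (∏ e, (M e).det) + ∑ e, (cof (M e) - (M e).det) * ∏ f ∈ univ.erase e, (M f).det) ∧
    -- `q`-distance matrices, `q - 1` invertible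
    (∀ {A : Type*} [AddMonoidWithOne A] (qpow : Multiplicative A →* R) (q r : R),
      qpow (.ofAdd 1) = q → (q - 1) * r = 1 →
      ∀ α : BlockMatrices G A, (∀ e i, α e i i = 0) →
        (qDist G (fun t => qpow (.ofAdd t)) r α).det =
          ∑ e, (qBlock G (fun t => qpow (.ofAdd t)) r α e).det *
            ∏ f ∈ univ.erase e, dStar q (qBlock G (fun t => qpow (.ofAdd t)) r α) f ∧
        cof (qDist G (fun t => qpow (.ofAdd t)) r α) =
          (∏ e, dStar q (qBlock G (fun t => qpow (.ofAdd t)) r α) e) -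
            (q - 1) * ∑ e, (qBlock G (fun t => qpow (.ofAdd t)) r α e).det *
              ∏ f ∈ univ.erase e, dStar q (qBlock G (fun t => qpow (.ofAdd t)) r α) f) ∧
    -- `q`-distance matrices with weights in `ℕ`, as polynomials in an arbitrary `q`
    (∀ (q : R) (α : BlockMatrices G ℕ), (∀ e i, α e i i = 0) →
      (∀ r : R, (q - 1) * r = 1 → qNatDist G q α = qDist G (fun k : ℕ => q ^ k) r α) ∧
      (qNatDist G q α).det =
        ∑ e, (qNatBlock G q α e).det * ∏ f ∈ univ.erase e, dStar q (qNatBlock G q α) f ∧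
      cof (qNatDist G q α) =
        (∏ e, dStar q (qNatBlock G q α) e) - (q - 1) * ∑ e, (qNatBlock G q α e).det *
          ∏ f ∈ univ.erase e, dStar q (qNatBlock G q α) f) ∧
    -- the classical distance matrix is the `q`-distance matrix at `q = 1`
    (∀ α : BlockMatrices G ℕ, (∀ e i, α e i i = 0) →
      qNatDist G (1 : R) α = classicalDist G (fun e => (α e).map (Nat.cast : ℕ → R))) ∧
    (∀ α : BlockMatrices G ℝ, (∀ e i, α e i i = 0) →
      Tendsto (fun q : ℝ => qDist G (fun t : ℝ => q ^ t) (q - 1)⁻¹ α) (𝓝[≠] 1)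
        (𝓝 (classicalDist G α))) ∧
    -- classical distance matrices
    (∀ α : BlockMatrices G R, (∀ e i, α e i i = 0) →
      (classicalDist G α).det = ∑ e, (α e).det * ∏ f ∈ univ.erase e, cof (α f) ∧
      cof (classicalDist G α) = ∏ e, cof (α e)) := by
  have hP := hG.preconnected
  refine ⟨⟨mem_common_block_or_separates hP, fun M X hM hX => ⟨multEntry_block hM,
    fun v i j => multEntry_of_separates M, addEntry_block hX,
    fun v i j => addEntry_of_separates M X⟩⟩, ?_, fun M => det_cof_multDist hP, ?_, ?_, ?_, ?_, ?_⟩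
  · intro a M hM
    refine ⟨(det_cof_amDist hP a hM).1, ?_⟩
    rw [(det_cof_amDist hP a hM).2, (det_cof_multDist hP hM).1, Finset.prod_mul_distrib,
      mul_comm (∏ e : Block G, a e ^ (#e.1 - 1))]
  · intro A _ qpow q r _ hr α hα
    have hM : ∀ e i, qPowBlock G (fun t => qpow (.ofAdd t)) α e i i = 1 := fun e i => by
      simp [qPowBlock, hα]
    exact det_cof_gluedDist_of_eq_one_add hP (amBlock_diag hM) fun e i j => by
      simp only [amBlock, J, Matrix.smul_apply, Matrix.sub_apply, Matrix.of_apply, smul_eq_mul]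
      linear_combination (1 - qPowBlock G (fun t => qpow (.ofAdd t)) α e i j) * hr
  · intro q α hα
    refine ⟨fun r hr => ?_, ?_⟩
    · rw [qNatDist, qDist, amDist]
      congr 1
      ext e i j
      have := pow_eq_one_add_mul_qNat q (α e i j)
      simp only [amBlock, qNatBlock, qPowBlock, J, Matrix.map_apply, Matrix.smul_apply,
        Matrix.sub_apply, Matrix.of_apply, smul_eq_mul]
      linear_combination (-r) * this - qNat q (α e i j) * hr
    · exact det_cof_gluedDist_of_eq_one_add hP (fun e i => by simp [qNatBlock, hα, qNat])
        fun e i j => pow_eq_one_add_mul_qNat q (α e i j)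
  · intro α _
    rw [qNatDist, classicalDist]
    congr 1
    · ext e i j
      simp [qPowBlock, J]
    · ext e i j
      simp [qNatBlock, qNat]
  · intro α hα
    refine tendsto_pi_nhds.2 fun i => tendsto_pi_nhds.2 fun j => ?_
    have hM : ∀ (t : ℝ) e i, qPowBlock G (fun s : ℝ => t ^ s) α e i i = 1 := fun t e i => by
      simp [qPowBlock, hα]
    refine tendsto_addEntry hP hM (fun _ _ => rfl) (fun t => amBlock_diag (hM t)) hα ?_ ?_ i j
    · intro e i j
      have h : ContinuousAt (fun q : ℝ => q ^ α e i j) 1 :=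
        Real.continuousAt_rpow_const _ _ (Or.inl one_ne_zero)
      simpa [ContinuousAt, J, qPowBlock] using h.tendsto.mono_left nhdsWithin_le_nhds
    · intro e i j
      -- The block entry (q^α - 1)/(q - 1) is the difference quotient of q^α at 1, whose limit is α.
      have h := hasDerivAt_iff_tendsto_slope.1
        (Real.hasDerivAt_rpow_const (x := 1) (p := α e i j) (Or.inl one_ne_zero))
      simpa [slope_fun_def, amBlock, qPowBlock, J] using h
  · intro α hα
    -- J = J + 0 · X: at c = 0 the constants b_e reduce to cofactor sums and the Leibniz term of cof
    -- vanishes.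
    have h := det_cof_gluedDist_of_eq_one_add hP (M := fun _ => J _ R) hα (c := 0)
      (fun e i j => by simp [J])
    simpa [classicalDist] using h
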